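/- Let $\mathbb{F}_q$ be a finite field with algebraic closure $\overline{\mathbb{F}_q}$, let $n \ge 1$, and let $f \in \mathbb{F}_q[x_1,\ldots,x_n]$ be an absolutely irreducible (that is, irreducible in $\overline{\mathbb{F}_q}[x_1,\ldots,x_n]$), not necessarily homogeneous, polynomial of total degree $d$. For $$(\mathbf{v},\mathbf{w},\mathbf{z}) = (v_1,\ldots,v_n,w_2,\ldots,w_n,z_2,\ldots,z_n) \in \mathbb{F}_q^{3n-2}$$ put $$f_{\mathbf{v},\mathbf{w},\mathbf{z}} = f(X+v_1,\; w_2X+z_2Y+v_2,\; \ldots,\; w_nX+z_nY+v_n) \in \mathbb{F}_q[X,Y].$$ (i) There are at most $$\tfrac18\left(3d^4-2d^3+13d^2+2d\right)q^{3n-3}$$ tuples $(\mathbf{v},\mathbf{w},\mathbf{z}) \in \mathbb{F}_q^{3n-2}$ such that $f_{\mathbf{v},\mathbf{w},\mathbf{z}}$ is not absolutely irreducible. (ii) For every positive integer $D<d$ there are at most $$\tfrac{d}{8}\left(-D^4+4D^3d-6D^3+12D^2d-11D^2+8Dd-6D+16d\right)q^{3n-3}$$ tuples $(\mathbf{v},\mathbf{w},\mathbf{z})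 \in \mathbb{F}_q^{3n-2}$ such that $f_{\mathbf{v},\mathbf{w},\mathbf{z}}$ has an irreducible factor of total degree at most $D$ in $\overline{\mathbb{F}_q}[X,Y]$. -/

import Mathlib

/-- A multivariate polynomial over a field `F` is absolutely irreducible if it is irreducible as a
polynomial over an algebraic closure of `F`. -/
def AbsolutelyIrreducible {F : Type*} [Field F] {σ : Type*} (f : MvPolynomial σ F) : Prop :=
  Irreducible (MvPolynomial.map (algebraMap F (AlgebraicClosure F)) f)

/-- The parameter tuples `(v, w, z) = (v₁, …, vₙ, w₂, …, wₙ, z₂, …, zₙ) ∈ F ^ (3n - 2)`, where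
`n = m + 1`: the component `w i` (`i : Fin m`) is the one that belongs to the variable
`i.succ : Fin (m + 1)`, and so is `z i`. -/
abbrev SliceParam (F : Type*) (m : ℕ) : Type _ :=
  (Fin (m + 1) → F) × (Fin m → F) × (Fin m → F)

/-- The planar slice
`f(X + v₁, w₂ X + z₂ Y + v₂, …, wₙ X + zₙ Y + vₙ) ∈ F[X, Y]` of a polynomial `f` in `n = m + 1`
variables, where `X` is the variable of index `0` and `Y` the variable of index `1`. -/
noncomputable def planeSlice {F : Type*} [Field F] {m : ℕ} (f : MvPolynomial (Fin (m + 1)) F)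
    (t : SliceParam F m) : MvPolynomial (Fin 2) F :=
  MvPolynomial.aeval
    (Fin.cons (MvPolynomial.X 0 + MvPolynomial.C (t.1 0))
      (fun i : Fin m => MvPolynomial.C (t.2.1 i) * MvPolynomial.X 0
        + MvPolynomial.C (t.2.2 i) * MvPolynomial.X 1 + MvPolynomial.C (t.1 i.succ)) :
      Fin (m + 1) → MvPolynomial (Fin 2) F) f

/-- `g`, considered over an algebraic closure of `F`, has an irreducible factor of total degree at
most `D`. -/
def HasGeomFactorOfDegreeLE {F : Type*} [Field F] {σ : Type*} (g : MvPolynomial σ F) (D : ℕ) :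
    Prop :=
  ∃ h : MvPolynomial σ (AlgebraicClosure F), Irreducible h ∧ h.totalDegree ≤ D ∧
    h ∣ MvPolynomial.map (algebraMap F (AlgebraicClosure F)) g

/-! Work over the algebraic closure and fix a line, that is, a pair `(v, w)`. The line is good if
the restriction of `f` to it has full degree `d` and only simple zeros; bad lines are zeros of
`lineDiscriminant`, a polynomial of degree at most `2 * d ^ 2`. It is nonzero because some partial
derivative of `f` is nonzero over a perfect field, so an irreducible generic slice with suitable
direction is separable (`lineDiscriminant_ne_zero`).

On a good line, let `z` be indeterminate. A simple zero `ζ` lifts to a power series branch `X =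
a(Y)` of the slice, whose coefficient of `Y ^ k` has degree at most `k` in `z` (`exists_branch`).
After specializing `z`, a factor of degree at most `D` through `(ζ, 0)` vanishes on the branch,
which is a linear relation between the `a ^ i * Y ^ j` with `i + j ≤ D`. For indeterminate `z` no
nontrivial relation holds even modulo `Y ^ (d * D + 1)`: the resultant with the slice has degree at
most `d * D` in `Y`, so it would vanish, against the irreducibility of the generic slice
(`eq_zero_of_pow_dvd_eval`). Hence the coefficient matrix has a nonzero maximal minor `Δ(z)`, which
vanishes at every bad `z` (`exists_polynomial_of_simple_zero`). Its rows are distinct indices up to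
`d * D`, and this bounds its degree by `minorDegree d D`.

If a slice is reducible, one of its factors passes through any chosen `ζ`, so a single minor with `D
= d - 1` serves for (i). A given low-degree factor may meet the line in any of the `d` zeros, so
(ii) needs the product of the minors over all of them. The Schwartz–Zippel bound, applied to `(v,
w)` and then to `z`, gives the count. -/

/-! ### Degrees of determinants and resultants, Newton iteration, maximal minors -/

/-- The determinant of a matrix of polynomials has total degree at most the sum of bounds for the
total degrees of the rows. -/
theorem MvPolynomial.totalDegree_det_le {ι σ R : Type*} [Fintype ι] [DecidableEq ι] [CommRing R]
    (A : Matrix ι ι (MvPolynomial σ R)) (r : ι → ℕ) (hA : ∀ i j, (A i j).totalDegree ≤ r i) :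
    A.det.totalDegree ≤ ∑ i, r i := by
  rw [Matrix.det_apply]
  refine totalDegree_finsetSum_le fun τ _ => ?_
  refine (totalDegree_smul_le _ _).trans ?_
  refine (totalDegree_finsetProd _ _).trans ?_
  rw [← Equiv.sum_comp τ r]
  exact Finset.sum_le_sum fun i _ => hA _ _

/-- A weighted degree bound for determinants. -/
theorem Polynomial.natDegree_det_add_le {ι R : Type*} [Fintype ι] [DecidableEq ι] [CommRing R]
    (A : Matrix ι ι (Polynomial R)) (r c : ι → ℕ)
    (hA : ∀ i j, A i j ≠ 0 → (A i j).natDegree + r i ≤ c j) :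
    A.det.natDegree ≤ ∑ i, c i - ∑ i, r i := by
  rw [Matrix.det_apply]
  refine natDegree_sum_le_of_forall_le _ _ fun τ _ => ?_
  refine (natDegree_smul_le _ _).trans ?_
  by_cases h0 : ∃ j, A (τ j) j = 0
  · obtain ⟨j, hj⟩ := h0
    have hz : ∏ j, A (τ j) j = 0 := Finset.prod_eq_zero (Finset.mem_univ j) hj
    have hz' : (∏ j, A (τ j) j).natDegree = 0 := by rw [hz, natDegree_zero]
    exact hz'.le.trans (Nat.zero_le _)
  push Not at h0
  refine (natDegree_prod_le _ _).trans ?_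
  have hsum := Finset.sum_le_sum fun j (_ : j ∈ Finset.univ) => hA _ _ (h0 j)
  rw [Finset.sum_add_distrib, Equiv.sum_comp τ r] at hsum
  exact Nat.le_sub_of_add_le hsum

/-- The resultant of two bivariate polynomials of total degrees at most `m` and `n` has degree at
most `m * n` in the remaining variable. -/
theorem Polynomial.natDegree_resultant_le {R : Type*} [CommRing R] (f g : Polynomial (Polynomial R))
    (m n : ℕ) (hf : ∀ i, f.coeff i ≠ 0 → (f.coeff i).natDegree + i ≤ m)
    (hg : ∀ i, g.coeff i ≠ 0 → (g.coeff i).natDegree + i ≤ n) :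
    (f.resultant g m n).natDegree ≤ m * n := by
  -- With row weight `i`, every nonzero entry of column `j` has degree plus `i` at most `c j`. The
  -- column weights exceed the row weights by `2 * m * n - m * n` in total.
  let c : Fin (m + n) → ℕ := Fin.addCases (fun j => n + j) (fun j => m + j)
  refine (natDegree_det_add_le (f.sylvester g m n) (fun i => (i : ℕ)) c fun i j hj => ?_).trans ?_
  · induction j using Fin.addCases with
    | left j =>
      simp only [sylvester, Matrix.of_apply, Fin.addCases_left, c] at hj ⊢
      split_ifs at hj ⊢ with h
      · have := hg _ hj
        have := h.1
        omega
      · exact absurd rfl hj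
    | right j =>
      simp only [sylvester, Matrix.of_apply, Fin.addCases_right, c] at hj ⊢
      split_ifs at hj ⊢ with h
      · have := hf _ hj
        have := h.1
        omega
      · exact absurd rfl hj
  · rw [Fin.sum_univ_add c, Fin.sum_univ_add]
    simp only [c, Fin.addCases_left, Fin.addCases_right, Finset.sum_add_distrib, Finset.sum_const,
      Finset.card_univ, Fintype.card_fin, smul_eq_mul, Fin.val_castAdd, Fin.val_natAdd]
    have := mul_comm m n
    omega

/-- Newton iteration: an approximate simple root improves to any order, inside every subset that is
stable under the iteration. -/
theorem Polynomial.exists_pow_dvd_eval {A : Type*} [CommRing A] (p : Polynomial A) (y a₀ c c' : A)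
    (hc : c' * c = 1) (h₀ : y ∣ p.eval a₀) (hd : y ∣ p.derivative.eval a₀ - c) (S : Set A)
    (ha₀ : a₀ ∈ S) (hS : ∀ a ∈ S, a - c' * p.eval a ∈ S) (N : ℕ) :
    ∃ a ∈ S, y ∣ a - a₀ ∧ y ^ (N + 1) ∣ p.eval a := by
  induction N with
  | zero => exact ⟨a₀, ha₀, by simp, by simpa using h₀⟩
  | succ N ih =>
    obtain ⟨a, haS, haa, hpa⟩ := ih
    have hya : y ∣ p.eval a := (dvd_pow_self y N.succ_ne_zero).trans hpa
    refine ⟨_, hS a haS, ?_, ?_⟩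
    · rw [sub_right_comm]
      exact dvd_sub haa (hya.mul_left _)
    · obtain ⟨k, hk⟩ := p.binomExpansion a (-(c' * p.eval a))
      have hda : y ∣ p.derivative.eval a - c := by
        have := (haa.trans (p.derivative.sub_dvd_eval_sub a a₀)).add hd
        simpa using this
      -- Correcting with the fixed inverse `c'` instead of the inverse of `p'(a)` gains only one
      -- order per step, but the iteration never leaves a set closed under multiplication by
      -- constants and evaluation of `p`.
      have key : p.eval (a - c' * p.eval a) =
          p.eval a * -(c' * (p.derivative.eval a - c)) + k * c' ^ 2 * (p.eval a * p.eval a) := by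
        rw [sub_eq_add_neg, hk]
        linear_combination (-p.eval a) * hc
      rw [key, pow_succ]
      refine dvd_add (mul_dvd_mul hpa ?_) ((mul_dvd_mul hpa hya).mul_left _)
      exact (hda.mul_left _).neg_right

/-- A matrix over a domain with trivial kernel has a nonzero maximal minor. -/
theorem Matrix.exists_det_submatrix_ne_zero {R ι κ : Type*} [CommRing R] [IsDomain R] [Fintype ι]
    [DecidableEq ι] [Finite κ] (A : Matrix κ ι R) (hA : ∀ h : ι → R, A.mulVec h = 0 → h = 0) :
    ∃ s : ι → κ, Function.Injective s ∧ (A.submatrix s id).det ≠ 0 := by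
  classical
  cases nonempty_fintype κ
  let L := FractionRing R
  let φ : R →+* L := algebraMap R L
  have hφ : Function.Injective φ := IsFractionRing.injective R L
  let B : Matrix κ ι L := A.map φ
  have hcols : LinearIndependent L B.transpose.row := by
    rw [← LinearIndependent.iff_fractionRing R L, Fintype.linearIndependent_iff]
    intro g hg i
    have : A.mulVec g = 0 := by
      ext k
      apply hφ
      have := congrFun hg k
      simp only [Finset.sum_apply, Algebra.smul_def, B, Pi.zero_apply] at this
      simp only [Matrix.mulVec, dotProduct, map_sum, map_mul, Pi.zero_apply, map_zero]
      rw [← this]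
      exact Finset.sum_congr rfl fun _ _ => mul_comm _ _
    exact congrFun (hA g this) i
  have hrank : B.rank = Fintype.card ι := by
    rw [← Matrix.rank_transpose]
    exact hcols.rank_matrix
  rw [Matrix.rank_eq_finrank_span_row] at hrank
  obtain ⟨τ, a, ha, hspan, hli⟩ := exists_linearIndependent' L B.row
  have : Finite τ := Finite.of_injective a ha
  cases nonempty_fintype τ
  have hcard : Fintype.card ι = Fintype.card τ := by
    rw [← hrank, ← hspan, linearIndependent_iff_card_eq_finrank_span.mp hli, Set.finrank]
  let e := Fintype.equivOfCardEq hcard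
  refine ⟨a ∘ e, ha.comp e.injective, fun h0 => ?_⟩
  have hli' : LinearIndependent L (B.submatrix (a ∘ e) id).row := hli.comp e e.injective
  rw [Matrix.linearIndependent_rows_iff_isUnit, Matrix.isUnit_iff_isUnit_det] at hli'
  apply hli'.ne_zero
  have : B.submatrix (a ∘ e) id = φ.mapMatrix (A.submatrix (a ∘ e) id) := rfl
  rw [this, ← RingHom.map_det, h0, map_zero]

theorem sum_range_card_le (t : Finset ℕ) : ∑ i ∈ Finset.range t.card, i ≤ ∑ i ∈ t, i := by
  induction t using Finset.induction_on_max with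
  | empty => simp
  | insert a s hs ih =>
    have ha : a ∉ s := fun h => (hs a h).false
    have hcard : s.card ≤ a := by
      have : s ⊆ Finset.range a := fun x hx => Finset.mem_range.mpr (hs x hx)
      simpa using Finset.card_le_card this
    rw [Finset.card_insert_of_notMem ha, Finset.sum_range_succ, Finset.sum_insert ha, add_comm]
    exact Nat.add_le_add hcard ih

/-- A bound for the sum of distinct natural numbers not exceeding `T`. -/
theorem sum_distinct_le {ι : Type*} [Fintype ι] (T : ℕ) (s : ι → Fin (T + 1))
    (hs : Function.Injective s) :
    2 * ∑ i, (s i : ℕ) + Fintype.card ι * (Fintype.card ι - 1) ≤ 2 * (Fintype.card ι * T) := by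
  classical
  -- The complements `T - s i` are again distinct, so their sum is at least `0 + 1 + ⋯`.
  have h1 : ∑ i ∈ Finset.range (Fintype.card ι), i ≤ ∑ i, (T - (s i : ℕ)) := by
    have hinj : Function.Injective fun i => T - (s i : ℕ) := by
      intro i j hij
      have := (s i).is_lt
      have := (s j).is_lt
      exact hs (Fin.ext (by simp only at hij; omega))
    have := sum_range_card_le (Finset.univ.image fun i => T - (s i : ℕ))
    rw [Finset.sum_image fun i _ j _ h => hinj h, Finset.card_image_of_injective _ hinj] at this
    exact this
  have h2 : ∑ i, (T - (s i : ℕ)) + ∑ i, (s i : ℕ) = Fintype.card ι * T := by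
    rw [← Finset.sum_add_distrib]
    simp [Finset.sum_congr rfl fun i _ => Nat.sub_add_cancel (Nat.lt_succ_iff.mp (s i).is_lt)]
  have h3 := Finset.sum_range_id_mul_two (Fintype.card ι)
  omega

/-! ### Zeros, filtrations and partial derivatives of multivariate polynomials -/

/-- The Schwartz–Zippel bound for points with coordinates in a finite subfield. -/
theorem MvPolynomial.card_zeros_mul_le {F K σ : Type*} [Field F] [Fintype F] [Field K]
    [Fintype σ] (φ : F →+* K) (p : MvPolynomial σ K) (hp : p ≠ 0) :
    {x : σ → F | eval (φ ∘ x) p = 0}.ncard * Fintype.card F ≤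
      p.totalDegree * Fintype.card F ^ Fintype.card σ := by
  classical
  let e := Fintype.equivFin σ
  let S : Finset K := Finset.univ.image φ
  have hS : S.card = Fintype.card F := Finset.card_image_of_injective _ φ.injective
  have hp' : rename e p ≠ 0 := (map_ne_zero_iff _ (rename_injective e e.injective)).mpr hp
  have h := schwartz_zippel_totalDegree hp' S
  have hq : 0 < Fintype.card F := Fintype.card_pos
  have hq' : (0 : ℚ≥0) < Fintype.card F := by exact_mod_cast hq
  rw [hS, div_le_div_iff₀ (by positivity) hq'] at h
  have h' : Finset.card {f ∈ Fintype.piFinset fun _ => S | eval f (rename e p) = 0} *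
      Fintype.card F ≤ (rename e p).totalDegree * Fintype.card F ^ Fintype.card σ := by exact_mod_cast h
  refine le_trans (Nat.mul_le_mul_right _ ?_)
    (h'.trans (Nat.mul_le_mul_right _ (totalDegree_rename_le e p)))
  rw [← Set.ncard_coe_finset]
  refine Set.ncard_le_ncard_of_injOn (fun x => φ ∘ x ∘ e.symm) ?_ ?_ (Finset.finite_toSet _)
  · intro x hx
    simp only [Finset.coe_filter, Set.mem_ofPred_eq, Fintype.mem_piFinset] at hx ⊢
    refine ⟨fun i => Finset.mem_image_of_mem _ (Finset.mem_univ _), ?_⟩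
    rw [eval_rename]
    simpa [Function.comp_def] using hx
  · intro x _ y _ hxy
    ext i
    have := congrFun hxy (e i)
    exact φ.injective (by simpa using this)

/-- Filtrations are respected by substitution. -/
theorem MvPolynomial.aeval_mem_filtration {σ K B : Type*} [Field K] [CommRing B] [Algebra K B]
    (W : ℕ → Submodule K B) (h1 : 1 ∈ W 0) (hmono : Monotone W)
    (hmul : ∀ a b x y, x ∈ W a → y ∈ W b → x * y ∈ W (a + b))
    (x : σ → B) (hx : ∀ i, x i ∈ W 1) (f : MvPolynomial σ K) :
    aeval x f ∈ W f.totalDegree := by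
  have hpow : ∀ i n, x i ^ n ∈ W n := by
    intro i n
    induction n with
    | zero => simpa using h1
    | succ n ih => rw [pow_succ]; exact hmul _ _ _ _ ih (hx i)
  rw [aeval_def, eval₂_eq]
  refine Submodule.sum_mem _ fun s hs => ?_
  rw [← Algebra.smul_def]
  refine Submodule.smul_mem _ _ (hmono (le_totalDegree hs) ?_)
  rw [Finsupp.sum]
  generalize s.support = t
  induction t using Finset.cons_induction with
  | empty => simpa using h1
  | cons a t ha ih => rw [Finset.prod_cons, Finset.sum_cons]; exact hmul _ _ _ _ (hpow _ _) ih

/-- An irreducible polynomial over a perfect field has a nonzero partial derivative. -/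
theorem MvPolynomial.exists_pderiv_ne_zero {σ K : Type*} [Field K] (p : ℕ) [Fact p.Prime]
    [CharP K p] [PerfectRing K p] {f : MvPolynomial σ K} (hf : Irreducible f) :
    ∃ i, pderiv i f ≠ 0 := by
  by_contra! h
  have hp := (Fact.out : p.Prime)
  have hdvd : ∀ s ∈ f.support, ∀ i, p ∣ s i := by
    intro s hs i
    by_cases hsi : s i = 0
    · simp [hsi]
    have hle : Finsupp.single i 1 ≤ s := by
      rw [Finsupp.single_le_iff]
      omega
    have := congrArg (coeff (s - Finsupp.single i 1)) (h i)
    rw [coeff_pderiv, tsub_add_cancel_of_le hle, coeff_zero, mul_eq_zero] at this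
    have := this.resolve_left (mem_support_iff.mp hs)
    rw [← CharP.cast_eq_zero_iff K p]
    have h2 : s i = (s - Finsupp.single i 1 : σ →₀ ℕ) i + 1 := by simp; omega
    rw [h2]
    exact_mod_cast this
  -- All exponents are divisible by `p` and all coefficients are `p`-th powers, so `f` itself is
  -- one.
  have hfp : f = (∑ s ∈ f.support,
      monomial (s.mapRange (· / p) (Nat.zero_div p)) ((frobeniusEquiv K p).symm (coeff s f))) ^ p := by
    have : CharP (MvPolynomial σ K) p := inferInstance
    rw [sum_pow_char]
    conv_lhs => rw [f.as_sum]
    refine Finset.sum_congr rfl fun s hs => ?_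
    rw [monomial_pow, frobeniusEquiv_symm_pow_p]
    have : p • s.mapRange (· / p) (Nat.zero_div p) = s := by
      ext i
      simp [Nat.mul_div_cancel' (hdvd s hs i)]
    rw [this]
  rw [hfp] at hf
  exact not_irreducible_pow hp.ne_one hf

/-! ### Slices in arbitrary algebras -/

/-- The value `f(x + v₁, w₂ x + s₂ + v₂, …, wₙ x + sₙ + vₙ)` in a commutative algebra. -/
noncomputable def slice {K B : Type*} [Field K] [CommRing B] [Algebra K B] {m : ℕ}
    (f : MvPolynomial (Fin (m + 1)) K) (v : Fin (m + 1) → B) (w s : Fin m → B) (x : B) : B :=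
  MvPolynomial.aeval (Fin.cons (x + v 0) (fun i : Fin m => w i * x + s i + v i.succ) :
    Fin (m + 1) → B) f

section

variable {K B B' : Type*} [Field K] [CommRing B] [Algebra K B] [CommRing B'] [Algebra K B'] {m : ℕ}

/-- All the slices below are instances of `slice`, so this naturality gives every specialization
between them. -/
theorem AlgHom.map_slice (φ : B →ₐ[K] B') (f : MvPolynomial (Fin (m + 1)) K)
    (v : Fin (m + 1) → B) (w s : Fin m → B) (x : B) :
    φ (slice f v w s x) = slice f (φ ∘ v) (φ ∘ w) (φ ∘ s) (φ x) := by
  rw [slice, slice, ← AlgHom.comp_apply, MvPolynomial.comp_aeval]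
  congr 2
  ext i
  refine Fin.cases ?_ (fun i => ?_) i <;> simp

theorem planeSlice_eq_slice (f : MvPolynomial (Fin (m + 1)) K) (t : SliceParam K m) :
    planeSlice f t = slice f (fun i => MvPolynomial.C (t.1 i)) (fun i => MvPolynomial.C (t.2.1 i))
      (fun i => MvPolynomial.C (t.2.2 i) * MvPolynomial.X 1) (MvPolynomial.X 0) :=
  rfl

theorem map_planeSlice {F : Type*} [Field F] (φ : F →+* K) (f : MvPolynomial (Fin (m + 1)) F)
    (t : SliceParam F m) :
    MvPolynomial.map φ (planeSlice f t) =
      planeSlice (MvPolynomial.map φ f) (φ ∘ t.1, φ ∘ t.2.1, φ ∘ t.2.2) := by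
  rw [planeSlice, planeSlice, MvPolynomial.map_aeval, MvPolynomial.aeval_def,
    MvPolynomial.eval₂_map]
  rw [MvPolynomial.coe_eval₂Hom]
  congr 1
  · ext a
    simp
  · ext1 i
    refine Fin.cases ?_ (fun i => ?_) i <;> simp

theorem slice_mem (S : Subalgebra K B) (f : MvPolynomial (Fin (m + 1)) K) {v : Fin (m + 1) → B}
    {w s : Fin m → B} {x : B} (hv : ∀ i, v i ∈ S) (hw : ∀ i, w i ∈ S) (hs : ∀ i, s i ∈ S)
    (hx : x ∈ S) : slice f v w s x ∈ S := by
  have hy : ∀ i, (Fin.cons (x + v 0) (fun i : Fin m => w i * x + s i + v i.succ) :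
      Fin (m + 1) → B) i ∈ S := by
    intro i
    refine Fin.cases ?_ (fun i => ?_) i
    · exact add_mem hx (hv 0)
    · exact add_mem (add_mem (mul_mem (hw i) hx) (hs i)) (hv _)
  have := MvPolynomial.aeval_range (R := K)
    (Fin.cons (x + v 0) (fun i : Fin m => w i * x + s i + v i.succ) : Fin (m + 1) → B)
  have hle : (MvPolynomial.aeval (R := K)
    (Fin.cons (x + v 0) (fun i : Fin m => w i * x + s i + v i.succ) : Fin (m + 1) → B)).range ≤ S := by
    rw [this]
    exact Algebra.adjoin_le (by rintro _ ⟨i, rfl⟩; exact hy i)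
  exact hle ⟨f, rfl⟩

theorem slice_mem_filtration (W : ℕ → Submodule K B) (h1 : 1 ∈ W 0) (hmono : Monotone W)
    (hmul : ∀ a b x y, x ∈ W a → y ∈ W b → x * y ∈ W (a + b))
    (f : MvPolynomial (Fin (m + 1)) K) {v : Fin (m + 1) → B} {w s : Fin m → B} {x : B}
    (hv : ∀ i, v i ∈ W 1) (hw : ∀ i, w i * x ∈ W 1) (hs : ∀ i, s i ∈ W 1) (hx : x ∈ W 1) :
    slice f v w s x ∈ W f.totalDegree := by
  refine MvPolynomial.aeval_mem_filtration W h1 hmono hmul _ (fun i => ?_) f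
  refine Fin.cases ?_ (fun i => ?_) i
  · exact add_mem hx (hv 0)
  · exact add_mem (add_mem (hw i) (hs i)) (hv _)

/-- The affine change of coordinates
`x₁ ↦ x₁ + v₁, xᵢ ↦ wᵢ x₁ + xᵢ + vᵢ` of a polynomial ring. -/
noncomputable def shear (v : Fin (m + 1) → K) (w : Fin m → K) :
    MvPolynomial (Fin (m + 1)) K ≃ₐ[K] MvPolynomial (Fin (m + 1)) K :=
  AlgEquiv.ofAlgHom
    (MvPolynomial.aeval (Fin.cons (MvPolynomial.X 0 + MvPolynomial.C (v 0)) (fun i : Fin m =>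
      MvPolynomial.C (w i) * MvPolynomial.X 0 + MvPolynomial.X i.succ +
        MvPolynomial.C (v i.succ))))
    (MvPolynomial.aeval (Fin.cons (MvPolynomial.X 0 - MvPolynomial.C (v 0)) (fun i : Fin m =>
      MvPolynomial.X i.succ - MvPolynomial.C (w i) * (MvPolynomial.X 0 - MvPolynomial.C (v 0)) -
        MvPolynomial.C (v i.succ))))
    (by
      ext1 i
      refine Fin.cases ?_ (fun i => ?_) i
      · simp [MvPolynomial.algHom_C]
      · simp only [AlgHom.comp_apply, MvPolynomial.aeval_X, Fin.cons_succ, Fin.cons_zero, map_sub,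
          map_mul, MvPolynomial.algHom_C, MvPolynomial.algebraMap_eq, AlgHom.id_apply]
        ring)
    (by
      ext1 i
      refine Fin.cases ?_ (fun i => ?_) i
      · simp [MvPolynomial.algHom_C]
      · simp only [AlgHom.comp_apply, MvPolynomial.aeval_X, Fin.cons_succ, Fin.cons_zero, map_add,
          map_mul, MvPolynomial.algHom_C, MvPolynomial.algebraMap_eq, AlgHom.id_apply]
        ring)

theorem finSuccEquiv_shear (v : Fin (m + 1) → K) (w : Fin m → K)
    (f : MvPolynomial (Fin (m + 1)) K) :
    MvPolynomial.finSuccEquiv K m (shear v w f) =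
      slice f (fun i => Polynomial.C (MvPolynomial.C (v i)))
        (fun i => Polynomial.C (MvPolynomial.C (w i)))
        (fun i => Polynomial.C (MvPolynomial.X i)) Polynomial.X := by
  have : ((MvPolynomial.finSuccEquiv K m).toAlgHom.comp (shear v w).toAlgHom) =
      MvPolynomial.aeval (Fin.cons (Polynomial.X + Polynomial.C (MvPolynomial.C (v 0)))
        (fun i : Fin m => Polynomial.C (MvPolynomial.C (w i)) * Polynomial.X +
          Polynomial.C (MvPolynomial.X i) + Polynomial.C (MvPolynomial.C (v i.succ)))) := by
    ext1 i
    have hC : ∀ a : K, (MvPolynomial.finSuccEquiv K m) (MvPolynomial.C a) =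
        Polynomial.C (MvPolynomial.C a) := fun a => by
      simp [MvPolynomial.finSuccEquiv_apply]
    refine Fin.cases ?_ (fun i => ?_) i <;>
      simp [shear, hC, MvPolynomial.finSuccEquiv_X_succ, MvPolynomial.finSuccEquiv_X_zero]
  exact DFunLike.congr_fun this f

/-- The slice with independent `s` is `f` after an invertible affine change of coordinates. -/
theorem irreducible_slice {f : MvPolynomial (Fin (m + 1)) K} (hf : Irreducible f)
    (v : Fin (m + 1) → K) (w : Fin m → K) :
    Irreducible (slice f (fun i => Polynomial.C (MvPolynomial.C (v i)))
        (fun i => Polynomial.C (MvPolynomial.C (w i)))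
        (fun i => Polynomial.C (MvPolynomial.X i)) Polynomial.X :
      Polynomial (MvPolynomial (Fin m) K)) := by
  rw [← finSuccEquiv_shear]
  exact (MulEquiv.irreducible_iff (MvPolynomial.finSuccEquiv K m)).mpr
    ((MulEquiv.irreducible_iff (shear v w)).mpr hf)

end

/-! ### Line slices and the generic planar slice -/

section

open Polynomial

variable {K : Type*} [Field K] {m : ℕ}

/-- The restriction `f(X + v₁, w₂ X + v₂, …, wₙ X + vₙ)` to a line. -/
noncomputable def lineSlice (f : MvPolynomial (Fin (m + 1)) K) (v : Fin (m + 1) → K)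
    (w : Fin m → K) : K[X] :=
  slice f (fun i => C (v i)) (fun i => C (w i)) (fun _ => 0) X

/-- The slice with given `v` and `w` and with indeterminates for `z`, as a polynomial in `X` with
coefficients that are polynomials in `Y`. -/
noncomputable def genericSlice (f : MvPolynomial (Fin (m + 1)) K) (v : Fin (m + 1) → K)
    (w : Fin m → K) : (MvPolynomial (Fin m) K)[X][X] :=
  slice f (fun i => C (C (MvPolynomial.C (v i)))) (fun i => C (C (MvPolynomial.C (w i))))
    (fun i => C (C (MvPolynomial.X i) * X)) X

theorem genericSlice_map_eval_zero (f : MvPolynomial (Fin (m + 1)) K) (v : Fin (m + 1) → K)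
    (w : Fin m → K) :
    (genericSlice f v w).map (evalRingHom 0) = (lineSlice f v w).map MvPolynomial.C := by
  let φ : (MvPolynomial (Fin m) K)[X] →ₐ[K] MvPolynomial (Fin m) K :=
    (aeval (0 : MvPolynomial (Fin m) K)).restrictScalars K
  have h1 : (genericSlice f v w).map (evalRingHom 0) = mapAlgHom φ (genericSlice f v w) := by
    rw [coe_mapAlgHom]
    congr 1
  have h2 : (lineSlice f v w).map MvPolynomial.C =
      mapAlgHom (Algebra.ofId K (MvPolynomial (Fin m) K)) (lineSlice f v w) := by
    rw [coe_mapAlgHom]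
    rfl
  rw [h1, h2, genericSlice, lineSlice, AlgHom.map_slice]
  refine (AlgHom.map_slice (B := (MvPolynomial (Fin m) K)[X][X])
    (B' := (MvPolynomial (Fin m) K)[X]) (mapAlgHom φ) _ _ _ _ _).trans ?_
  congr 1
  · ext1 i; simp [φ]
  · ext1 i; simp [φ]
  · ext1 i; simp [φ]
  · simp

/-- Setting `Y = 1` turns `z i * Y` into an independent variable, so that the result is a sheared
copy of `f`; irreducibility reaches the generic slice this way. -/
theorem genericSlice_map_eval_one (f : MvPolynomial (Fin (m + 1)) K) (v : Fin (m + 1) → K)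
    (w : Fin m → K) :
    (genericSlice f v w).map (evalRingHom 1) =
      slice f (fun i => C (MvPolynomial.C (v i))) (fun i => C (MvPolynomial.C (w i)))
        (fun i => C (MvPolynomial.X i)) X := by
  let φ : (MvPolynomial (Fin m) K)[X] →ₐ[K] MvPolynomial (Fin m) K :=
    (aeval (1 : MvPolynomial (Fin m) K)).restrictScalars K
  have h1 : (genericSlice f v w).map (evalRingHom 1) = mapAlgHom φ (genericSlice f v w) := by
    rw [coe_mapAlgHom]
    congr 1
  rw [h1, genericSlice]
  refine (AlgHom.map_slice (B := (MvPolynomial (Fin m) K)[X][X])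
    (B' := (MvPolynomial (Fin m) K)[X]) (mapAlgHom φ) _ _ _ _ _).trans ?_
  congr 1
  · ext1 i; simp [φ]
  · ext1 i; simp [φ]
  · ext1 i; simp [φ]
  · simp

theorem eval_genericSlice (f : MvPolynomial (Fin (m + 1)) K) (v : Fin (m + 1) → K)
    (w : Fin m → K) (a : (MvPolynomial (Fin m) K)[X]) :
    (genericSlice f v w).eval a = slice f (fun i => C (MvPolynomial.C (v i)))
      (fun i => C (MvPolynomial.C (w i))) (fun i => C (MvPolynomial.X i) * X) a := by
  have h1 : (genericSlice f v w).eval a =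
    ((aeval a).restrictScalars K : (MvPolynomial (Fin m) K)[X][X] →ₐ[K] _)
      (genericSlice f v w) := by simp
  rw [h1, genericSlice]
  refine (AlgHom.map_slice (B := (MvPolynomial (Fin m) K)[X][X])
    (B' := (MvPolynomial (Fin m) K)[X]) _ _ _ _ _ _).trans ?_
  congr 1
  · ext1 i; simp
  · ext1 i; simp
  · ext1 i; simp
  · simp

theorem aeval_planeSlice (f : MvPolynomial (Fin (m + 1)) K) (t : SliceParam K m) (a : K[X]) :
    MvPolynomial.aeval ![a, X] (planeSlice f t) =
      slice f (fun i => C (t.1 i)) (fun i => C (t.2.1 i)) (fun i => C (t.2.2 i) * X) a := by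
  rw [planeSlice_eq_slice, AlgHom.map_slice]
  congr 1
  · ext1 i; simp [MvPolynomial.algHom_C, Polynomial.algebraMap_eq]
  · ext1 i; simp [MvPolynomial.algHom_C, Polynomial.algebraMap_eq]
  · ext1 i; simp [MvPolynomial.algHom_C, Polynomial.algebraMap_eq]
  · simp

theorem map_eval_genericSlice (f : MvPolynomial (Fin (m + 1)) K) (v : Fin (m + 1) → K)
    (w z : Fin m → K) (a : (MvPolynomial (Fin m) K)[X]) :
    ((genericSlice f v w).eval a).map (MvPolynomial.eval z) =
      MvPolynomial.aeval ![a.map (MvPolynomial.eval z), X] (planeSlice f (v, w, z)) := by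
  have h1 : ∀ b : (MvPolynomial (Fin m) K)[X], b.map (MvPolynomial.eval z) =
      mapAlgHom (MvPolynomial.aeval z) b := by
    intro b
    rw [coe_mapAlgHom]
    rfl
  rw [eval_genericSlice, aeval_planeSlice, h1, h1, AlgHom.map_slice]
  congr 1
  · ext1 i; simp
  · ext1 i; simp
  · ext1 i; simp

/-- Restriction of a planar slice to the line `Y = 0`. -/
theorem aeval_planeSlice_X_zero (f : MvPolynomial (Fin (m + 1)) K) (t : SliceParam K m) :
    MvPolynomial.aeval ![X, (0 : K[X])] (planeSlice f t) = lineSlice f t.1 t.2.1 := by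
  rw [planeSlice_eq_slice, AlgHom.map_slice, lineSlice]
  congr 1
  · ext1 i; simp [MvPolynomial.algHom_C, Polynomial.algebraMap_eq]
  · ext1 i; simp [MvPolynomial.algHom_C, Polynomial.algebraMap_eq]
  · ext1 i; simp
  · simp

theorem totalDegree_planeSlice_le (f : MvPolynomial (Fin (m + 1)) K) (t : SliceParam K m) :
    (planeSlice f t).totalDegree ≤ f.totalDegree := by
  rw [← MvPolynomial.mem_restrictTotalDegree, planeSlice_eq_slice]
  refine slice_mem_filtration (MvPolynomial.restrictTotalDegree (Fin 2) K) ?_ ?_ ?_ f ?_ ?_ ?_ ?_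
  · simp [MvPolynomial.mem_restrictTotalDegree]
  · intro a b hab x hx
    rw [MvPolynomial.mem_restrictTotalDegree] at *
    exact hx.trans hab
  · intro a b x y hx hy
    rw [MvPolynomial.mem_restrictTotalDegree] at *
    exact (MvPolynomial.totalDegree_mul _ _).trans (Nat.add_le_add hx hy)
  all_goals simp only [MvPolynomial.mem_restrictTotalDegree]
  · simp
  · intro i
    exact (MvPolynomial.totalDegree_mul _ _).trans (by simp)
  · intro i
    exact (MvPolynomial.totalDegree_mul _ _).trans (by simp)
  · simp

/-- The filtration of a bivariate polynomial ring by total degree. -/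
def bidegreeLE (K R : Type*) [Field K] [CommRing R] [Algebra K R] (e : ℕ) :
    Submodule K R[X][X] where
  carrier := {p | ∀ i j, e < i + j → (p.coeff i).coeff j = 0}
  zero_mem' := by simp
  add_mem' := by
    intro a b ha hb i j hij
    simp [ha i j hij, hb i j hij]
  smul_mem' := by
    intro c a ha i j hij
    simp [ha i j hij]

theorem mem_bidegreeLE {R : Type*} [CommRing R] [Algebra K R] {e : ℕ} {p : R[X][X]} :
    p ∈ bidegreeLE K R e ↔ ∀ i j, e < i + j → (p.coeff i).coeff j = 0 :=
  Iff.rfl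

theorem mul_mem_bidegreeLE {R : Type*} [CommRing R] [Algebra K R] {a b : ℕ} {p q : R[X][X]}
    (hp : p ∈ bidegreeLE K R a) (hq : q ∈ bidegreeLE K R b) : p * q ∈ bidegreeLE K R (a + b) := by
  intro i j hij
  rw [coeff_mul, finsetSum_coeff]
  refine Finset.sum_eq_zero fun x hx => ?_
  rw [coeff_mul]
  refine Finset.sum_eq_zero fun y hy => ?_
  rw [Finset.HasAntidiagonal.mem_antidiagonal] at hx hy
  by_cases h : a < x.1 + y.1
  · rw [hp _ _ h, zero_mul]
  · rw [hq x.2 y.2 (by omega), mul_zero]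

theorem natDegree_coeff_add_le {R : Type*} [CommRing R] [Algebra K R] {e : ℕ} {p : R[X][X]}
    (hp : p ∈ bidegreeLE K R e) (i : ℕ) (hi : p.coeff i ≠ 0) :
    (p.coeff i).natDegree + i ≤ e := by
  by_contra! h
  exact hi (leadingCoeff_eq_zero.mp (hp i (p.coeff i).natDegree (by omega)))

theorem natDegree_le_of_mem_bidegreeLE {R : Type*} [CommRing R] [Algebra K R] {e : ℕ} {p : R[X][X]}
    (hp : p ∈ bidegreeLE K R e) : p.natDegree ≤ e := by
  rw [natDegree_le_iff_coeff_eq_zero]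
  intro i hi
  ext j
  exact hp i j (by omega)

theorem genericSlice_mem (f : MvPolynomial (Fin (m + 1)) K) (v : Fin (m + 1) → K)
    (w : Fin m → K) :
    genericSlice f v w ∈ bidegreeLE K (MvPolynomial (Fin m) K) f.totalDegree := by
  refine slice_mem_filtration _ ?_ ?_ (fun a b x y => mul_mem_bidegreeLE) f ?_ ?_ ?_ ?_
  · intro i j hij
    rw [coeff_one]
    split_ifs with h
    · rw [coeff_one, if_neg (by omega)]
    · simp
  · intro a b hab p hp i j hij
    exact hp i j (by omega)
  all_goals simp only [mem_bidegreeLE, coeff_C, coeff_X, coeff_C_mul]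
  · intro k i j hij
    split_ifs
    · rw [coeff_C, if_neg (by omega)]
    · simp
  · intro k i j hij
    split_ifs
    · rw [coeff_one, if_neg (by omega), mul_zero]
    · simp
  · intro k i j hij
    split_ifs
    · rw [coeff_C_mul, coeff_X, if_neg (by omega), mul_zero]
    · simp
  · intro i j hij
    split_ifs
    · rw [coeff_one, if_neg (by omega)]
    · simp

/-- The bound on the total degree in `X` and `Y` leaves only the constant term in `Y`, which is read
off at `Y = 0`. -/
theorem genericSlice_coeff (f : MvPolynomial (Fin (m + 1)) K) (v : Fin (m + 1) → K)
    (w : Fin m → K) :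
    (genericSlice f v w).coeff f.totalDegree =
      C (MvPolynomial.C ((lineSlice f v w).coeff f.totalDegree)) := by
  have h := congrArg (fun p => p.coeff f.totalDegree) (genericSlice_map_eval_zero f v w)
  simp only [coeff_map, coe_evalRingHom, ← coeff_zero_eq_eval_zero] at h
  ext1 j
  rw [coeff_C]
  split_ifs with hj
  · rw [hj, h]
  · exact genericSlice_mem f v w _ _ (by omega)

theorem natDegree_lineSlice_le (f : MvPolynomial (Fin (m + 1)) K) (v : Fin (m + 1) → K)
    (w : Fin m → K) : (lineSlice f v w).natDegree ≤ f.totalDegree := by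
  have h1 := (natDegree_map_eq_of_injective (MvPolynomial.C_injective (Fin m) K)
    (lineSlice f v w)).symm
  rw [← genericSlice_map_eval_zero] at h1
  rw [h1]
  exact natDegree_map_le.trans (natDegree_le_of_mem_bidegreeLE (genericSlice_mem f v w))

/-- The leading coefficient in `X` is a nonzero constant, so the slice is monic up to a unit. A
monic polynomial with an irreducible specialization, here at `Y = 1`, is irreducible, and Gauss's
lemma passes to the fraction field. -/
theorem irreducible_map_genericSlice {f : MvPolynomial (Fin (m + 1)) K} (hf : Irreducible f)
    (v : Fin (m + 1) → K) (w : Fin m → K)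
    (hu : (lineSlice f v w).coeff f.totalDegree ≠ 0) :
    Irreducible ((genericSlice f v w).map (algebraMap (MvPolynomial (Fin m) K)[X]
      (FractionRing (MvPolynomial (Fin m) K)[X]))) := by
  set c := (lineSlice f v w).coeff f.totalDegree with hc
  have hunit : IsUnit (C (C (MvPolynomial.C c⁻¹)) : (MvPolynomial (Fin m) K)[X][X]) :=
    (((IsUnit.mk0 _ (inv_ne_zero hu)).map MvPolynomial.C).map C).map C
  set p := C (C (MvPolynomial.C c⁻¹)) * genericSlice f v w with hp
  have hmonic : p.Monic := by
    refine monic_of_natDegree_le_of_coeff_eq_one f.totalDegree ?_ ?_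
    · exact (natDegree_C_mul_le _ _).trans (natDegree_le_of_mem_bidegreeLE (genericSlice_mem f v w))
    · rw [hp, coeff_C_mul, genericSlice_coeff, ← hc, ← C_mul, ← MvPolynomial.C_mul,
        inv_mul_cancel₀ hu]
      simp
  have hirr : Irreducible p := by
    refine hmonic.irreducible_of_irreducible_map (evalRingHom 1) p ?_
    have h2 := hunit.map (mapRingHom (evalRingHom (1 : MvPolynomial (Fin m) K)))
    rw [hp, Polynomial.map_mul, genericSlice_map_eval_one]
    exact (irreducible_isUnit_mul h2).mpr (irreducible_slice hf v w)
  rw [hmonic.irreducible_iff_irreducible_map_fraction_map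
    (K := FractionRing (MvPolynomial (Fin m) K)[X]), hp, Polynomial.map_mul] at hirr
  exact (irreducible_isUnit_mul (hunit.map (mapRingHom _))).mp hirr

end

/-! ### Branches through simple zeros and the obstruction polynomial in `z` -/

section

open Polynomial

variable {K : Type*} [Field K] {m : ℕ}

/-- A polynomial of small total degree that vanishes to high order on a branch of the generic slice
is zero. -/
theorem eq_zero_of_pow_dvd_eval {f : MvPolynomial (Fin (m + 1)) K} (hf : Irreducible f)
    (v : Fin (m + 1) → K) (w : Fin m → K) (hu : (lineSlice f v w).coeff f.totalDegree ≠ 0)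
    {D : ℕ} (hD : D < f.totalDegree) (a : (MvPolynomial (Fin m) K)[X])
    (ha : X ^ (f.totalDegree * D + 1) ∣ (genericSlice f v w).eval a)
    (H : (MvPolynomial (Fin m) K)[X][X]) (hH : H ∈ bidegreeLE K (MvPolynomial (Fin m) K) D)
    (hHa : X ^ (f.totalDegree * D + 1) ∣ H.eval a) : H = 0 := by
  set d := f.totalDegree with hd
  set G := genericSlice f v w with hG
  have hGW := genericSlice_mem f v w
  rw [← hG, ← hd] at hGW
  have hGd : G.natDegree ≤ d := natDegree_le_of_mem_bidegreeLE hGW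
  have hHd : H.natDegree ≤ D := natDegree_le_of_mem_bidegreeLE hH
  have hres : G.resultant H d D = 0 := by
    -- The resultant lies in the ideal generated by `G` and `H`. Evaluated at `a` this makes it
    -- divisible by a power of `Y` beyond its degree.
    obtain ⟨p, q, -, -, hpq⟩ := exists_mul_add_mul_eq_C_resultant G H hGd hHd (Or.inl (by omega))
    have h1 := congrArg (eval a) hpq
    rw [eval_add, eval_mul, eval_mul, eval_C] at h1
    have h2 : X ^ (d * D + 1) ∣ G.resultant H d D := by
      rw [← h1]
      exact dvd_add (ha.mul_right _) (hHa.mul_right _)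
    by_contra h0
    have h3 := natDegree_le_of_dvd h2 h0
    rw [natDegree_X_pow] at h3
    have h4 := natDegree_resultant_le G H d D (natDegree_coeff_add_le hGW)
      (natDegree_coeff_add_le hH)
    omega
  by_contra hH0
  let φ := algebraMap (MvPolynomial (Fin m) K)[X] (FractionRing (MvPolynomial (Fin m) K)[X])
  have hφ : Function.Injective φ := IsFractionRing.injective _ _
  have hGirr : Irreducible (G.map φ) := irreducible_map_genericSlice hf v w hu
  have hGcoeff : (G.map φ).coeff d ≠ 0 := by
    rw [coeff_map, hG, hd, genericSlice_coeff]
    simpa [map_ne_zero_iff _ hφ] using hu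
  have hGnat : (G.map φ).natDegree = d :=
    le_antisymm (natDegree_map_le.trans hGd) (le_natDegree_of_ne_zero hGcoeff)
  have hHnat : (H.map φ).natDegree ≤ D := natDegree_map_le.trans hHd
  have hHne : H.map φ ≠ 0 := (Polynomial.map_ne_zero_iff hφ).mpr hH0
  have hres' : (G.map φ).resultant (H.map φ) d D = 0 := by
    rw [resultant_map_map, hres, map_zero]
  -- The formal degree `D` may exceed the true degree of `H`; the excess contributes only powers of
  -- the nonzero leading coefficient of `G`, up to sign.
  obtain ⟨k, hk⟩ := Nat.exists_eq_add_of_le hHnat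
  rw [hk, resultant_add_right_deg _ _ _ _ _ le_rfl, mul_eq_zero] at hres'
  have hres'' := hres'.resolve_left (pow_ne_zero _ hGcoeff)
  rw [← hGnat, resultant_eq_zero_iff] at hres''
  have hdvd : G.map φ ∣ H.map φ := by
    by_contra hnd
    exact hres''.2 (hGirr.coprime_iff_not_dvd.mpr hnd)
  have := natDegree_le_of_dvd hdvd hHne
  omega

/-- The polynomials in `Y` over a polynomial ring, the coefficient of `Y ^ k` of which has total
degree at most `k`. -/
def weightedSubalgebra (K σ : Type*) [Field K] : Subalgebra K (MvPolynomial σ K)[X] where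
  carrier := {p | ∀ k, (p.coeff k).totalDegree ≤ k}
  mul_mem' := by
    intro a b ha hb k
    rw [coeff_mul]
    refine MvPolynomial.totalDegree_finsetSum_le fun x hx => ?_
    rw [Finset.HasAntidiagonal.mem_antidiagonal] at hx
    refine (MvPolynomial.totalDegree_mul _ _).trans ?_
    rw [← hx]
    exact Nat.add_le_add (ha _) (hb _)
  add_mem' := by
    intro a b ha hb k
    rw [coeff_add]
    exact (MvPolynomial.totalDegree_add _ _).trans (max_le (ha k) (hb k))
  algebraMap_mem' := by
    intro r k
    rw [Polynomial.algebraMap_apply, MvPolynomial.algebraMap_eq, coeff_C]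
    split_ifs <;> simp

theorem mem_weightedSubalgebra {σ : Type*} {p : (MvPolynomial σ K)[X]} :
    p ∈ weightedSubalgebra K σ ↔ ∀ k, (p.coeff k).totalDegree ≤ k :=
  Iff.rfl

theorem C_C_mem_weightedSubalgebra {σ : Type*} (c : K) :
    C (MvPolynomial.C c) ∈ weightedSubalgebra K σ :=
  (weightedSubalgebra K σ).algebraMap_mem c

theorem X_mem_weightedSubalgebra {σ : Type*} :
    (X : (MvPolynomial σ K)[X]) ∈ weightedSubalgebra K σ := by
  intro k
  rw [coeff_X]
  split_ifs <;> simp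

/-- A simple zero of a line slice extends to a branch of the generic slice, up to any order. -/
theorem exists_branch (f : MvPolynomial (Fin (m + 1)) K) (v : Fin (m + 1) → K) (w : Fin m → K)
    {ζ : K} (hζ : (lineSlice f v w).eval ζ = 0) (hζ' : (lineSlice f v w).derivative.eval ζ ≠ 0)
    (N : ℕ) :
    ∃ a ∈ weightedSubalgebra K (Fin m), X ∣ a - C (MvPolynomial.C ζ) ∧
      X ^ (N + 1) ∣ (genericSlice f v w).eval a := by
  set c := (lineSlice f v w).derivative.eval ζ with hc
  have hev : ∀ (p : (MvPolynomial (Fin m) K)[X][X]) (u : K[X]),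
      p.map (evalRingHom 0) = u.map MvPolynomial.C →
      (p.eval (C (MvPolynomial.C ζ))).coeff 0 = MvPolynomial.C (u.eval ζ) := by
    intro p u h
    have h1 := congrArg (eval (MvPolynomial.C ζ)) h
    rw [eval_map_apply] at h1
    rw [← h1, coeff_zero_eq_eval_zero]
    have h2 := eval_map_apply (evalRingHom (0 : MvPolynomial (Fin m) K)) (p := p)
      (C (MvPolynomial.C ζ))
    simpa using h2.symm
  refine exists_pow_dvd_eval (genericSlice f v w) X (C (MvPolynomial.C ζ)) (C (MvPolynomial.C c))
    (C (MvPolynomial.C c⁻¹)) ?_ ?_ ?_ (weightedSubalgebra K (Fin m)) ?_ ?_ N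
  · rw [← C_mul, ← MvPolynomial.C_mul, inv_mul_cancel₀ hζ']
    simp
  · rw [X_dvd_iff, hev _ _ (genericSlice_map_eval_zero f v w), hζ, map_zero]
  · rw [X_dvd_iff, coeff_sub, coeff_C_zero, hev _ (lineSlice f v w).derivative, ← hc, sub_self]
    rw [← derivative_map, genericSlice_map_eval_zero, derivative_map]
  · exact C_C_mem_weightedSubalgebra ζ
  · intro a ha
    refine sub_mem ha (mul_mem (C_C_mem_weightedSubalgebra _) ?_)
    -- Each `z i` occurs only in the product `z i * Y`, of weight one, so the Newton step preserves
    -- the weighted subalgebra.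
    rw [eval_genericSlice]
    refine slice_mem _ _ (fun i => C_C_mem_weightedSubalgebra _)
      (fun i => C_C_mem_weightedSubalgebra _) (fun i => ?_) ha
    intro k
    rw [coeff_C_mul, coeff_X]
    split_ifs with h
    · simp [← h]
    · simp

/-- The exponents of the monomials in two variables of total degree at most `D`. -/
def exponentsLE (D : ℕ) : Finset (ℕ × ℕ) :=
  (Finset.range (D + 1)).biUnion Finset.HasAntidiagonal.antidiagonal

theorem mem_exponentsLE {D : ℕ} {p : ℕ × ℕ} : p ∈ exponentsLE D ↔ p.1 + p.2 ≤ D := by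
  simp [exponentsLE]

theorem card_exponentsLE (D : ℕ) : 2 * (exponentsLE D).card = (D + 1) * (D + 2) := by
  rw [exponentsLE, Finset.card_biUnion]
  · simp only [Finset.Nat.card_antidiagonal]
    have h := Finset.sum_range_id_mul_two (D + 2)
    rw [Finset.sum_range_succ'] at h
    simp only [add_zero] at h
    rw [mul_comm, h]
    simp [mul_comm]
  · intro i _ j _ hij
    rw [Function.onFun, Finset.disjoint_left]
    intro x hx hx'
    rw [Finset.HasAntidiagonal.mem_antidiagonal] at hx hx'
    exact hij (hx.symm.trans hx')

/-- The exponent vector of a monomial in two variables. -/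
noncomputable def pairExponent (p : ℕ × ℕ) : Fin 2 →₀ ℕ :=
  Finsupp.equivFunOnFinite.symm ![p.1, p.2]

theorem pairExponent_injective : Function.Injective pairExponent := by
  intro p q h
  have h0 := DFunLike.congr_fun h 0
  have h1 := DFunLike.congr_fun h 1
  simp [pairExponent] at h0 h1
  exact Prod.ext h0 h1

theorem exists_pairExponent_of_mem_support {h : MvPolynomial (Fin 2) K} {D : ℕ}
    (hD : h.totalDegree ≤ D) {s : Fin 2 →₀ ℕ} (hs : s ∈ h.support) :
    ∃ p ∈ exponentsLE D, pairExponent p = s := by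
  refine ⟨(s 0, s 1), ?_, ?_⟩
  · rw [mem_exponentsLE]
    have := (MvPolynomial.le_totalDegree hs).trans hD
    rwa [Finsupp.sum_fintype _ _ (fun _ => rfl), Fin.sum_univ_two] at this
  · ext i
    fin_cases i <;> simp [pairExponent]

theorem aeval_eq_sum_exponentsLE {B : Type*} [CommRing B] [Algebra K B]
    {h : MvPolynomial (Fin 2) K} {D : ℕ} (hD : h.totalDegree ≤ D) (a b : B) :
    MvPolynomial.aeval ![a, b] h =
      ∑ p : exponentsLE D, algebraMap K B (h.coeff (pairExponent p)) *
        (a ^ (p : ℕ × ℕ).1 * b ^ (p : ℕ × ℕ).2) := by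
  classical
  rw [MvPolynomial.aeval_def, MvPolynomial.eval₂_eq']
  rw [Finset.sum_coe_sort (exponentsLE D) (fun p => algebraMap K B (h.coeff (pairExponent p)) *
    (a ^ p.1 * b ^ p.2))]
  have hsub : h.support ⊆ (exponentsLE D).image pairExponent := fun s hs =>
    Finset.mem_image.mpr (exists_pairExponent_of_mem_support hD hs)
  rw [Finset.sum_subset hsub, Finset.sum_image fun _ _ _ _ h => pairExponent_injective h]
  · simp [pairExponent]
  · intro s _ hs
    rw [MvPolynomial.notMem_support_iff.mp hs]
    simp

theorem eval_aeval_X_zero (h : MvPolynomial (Fin 2) K) (ζ : K) :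
    (MvPolynomial.aeval ![X, (0 : K[X])] h).eval ζ = MvPolynomial.eval ![ζ, 0] h := by
  have h1 : (Polynomial.aeval ζ).comp (MvPolynomial.aeval ![X, (0 : K[X])]) =
      MvPolynomial.aeval ![ζ, 0] := by
    ext1 i
    fin_cases i <;> simp
  have := DFunLike.congr_fun h1 h
  simpa [MvPolynomial.aeval_eq_eval] using this

/-- For a simple zero `ζ` of a line slice, the planar slices that have a factor of degree at most
`D` through `(ζ, 0)` correspond to zeros of a nonzero polynomial. -/
theorem exists_polynomial_of_simple_zero {f : MvPolynomial (Fin (m + 1)) K} (hf : Irreducible f)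
    (v : Fin (m + 1) → K) (w : Fin m → K) (hu : (lineSlice f v w).coeff f.totalDegree ≠ 0)
    {ζ : K} (hζ : (lineSlice f v w).eval ζ = 0) (hζ' : (lineSlice f v w).derivative.eval ζ ≠ 0)
    {D : ℕ} (hD : D < f.totalDegree) :
    ∃ Δ : MvPolynomial (Fin m) K, Δ ≠ 0 ∧
      2 * Δ.totalDegree + (exponentsLE D).card * ((exponentsLE D).card - 1) ≤
        2 * ((exponentsLE D).card * (f.totalDegree * D)) ∧
      ∀ (z : Fin m → K) (h : MvPolynomial (Fin 2) K), h ∣ planeSlice f (v, w, z) → h ≠ 0 →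
        h.totalDegree ≤ D → MvPolynomial.eval ![ζ, 0] h = 0 → MvPolynomial.eval z Δ = 0 := by
  classical
  set N := f.totalDegree * D with hN
  obtain ⟨a, haS, haζ, haN⟩ := exists_branch f v w hζ hζ' N
  -- Columns are the monomials of degree at most `D` on the branch, rows their coefficients of `Y ^
  -- k` for `k ≤ d * D`.
  let A : Matrix (Fin (N + 1)) (exponentsLE D) (MvPolynomial (Fin m) K) :=
    .of fun k p => (a ^ (p : ℕ × ℕ).1 * X ^ (p : ℕ × ℕ).2).coeff k
  have hdeg : ∀ k p, (A k p).totalDegree ≤ k := fun k p =>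
    (mul_mem (pow_mem haS _) (pow_mem X_mem_weightedSubalgebra _) :
      a ^ (p : ℕ × ℕ).1 * X ^ (p : ℕ × ℕ).2 ∈ weightedSubalgebra K (Fin m)) k
  have hker : ∀ g : exponentsLE D → MvPolynomial (Fin m) K, A.mulVec g = 0 → g = 0 := by
    intro g hg
    let H : (MvPolynomial (Fin m) K)[X][X] :=
      ∑ p : exponentsLE D, monomial (p : ℕ × ℕ).1 (monomial (p : ℕ × ℕ).2 (g p))
    have hHcoeff : ∀ i j, (H.coeff i).coeff j =
        ∑ p : exponentsLE D, if (p : ℕ × ℕ).1 = i then (if (p : ℕ × ℕ).2 = j then g p else 0) else 0 := by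
      intro i j
      simp only [H, finsetSum_coeff, coeff_monomial]
      refine Finset.sum_congr rfl fun p _ => ?_
      split_ifs with h1 h2 <;> simp [coeff_monomial, *]
    have hH0 : H = 0 := by
      refine eq_zero_of_pow_dvd_eval hf v w hu hD a haN H ?_ ?_
      · intro i j hij
        rw [hHcoeff]
        refine Finset.sum_eq_zero fun p _ => ?_
        have := mem_exponentsLE.mp p.2
        split_ifs <;> first | rfl | omega
      · rw [X_pow_dvd_iff]
        intro k hk
        have hk' := congrFun hg ⟨k, hk⟩
        simp only [H, eval_finsetSum, eval_monomial, finsetSum_coeff]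
        rw [Pi.zero_apply] at hk'
        rw [← hk', Matrix.mulVec, dotProduct]
        refine Finset.sum_congr rfl fun p _ => ?_
        rw [← C_mul_X_pow_eq_monomial, mul_assoc, coeff_C_mul, mul_comm (g p), mul_comm (X ^ _)]
        rfl
    ext1 p
    have h1 := hHcoeff (p : ℕ × ℕ).1 (p : ℕ × ℕ).2
    rw [hH0, Finset.sum_eq_single p] at h1
    · simpa using h1.symm
    · intro q _ hq
      split_ifs with h1 h2
      · exact absurd (Subtype.ext (Prod.ext h1 h2)) hq
      · rfl
      · rfl
    · simp
  obtain ⟨s, hs, hdet⟩ := Matrix.exists_det_submatrix_ne_zero A hker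
  refine ⟨_, hdet, ?_, ?_⟩
  · have h1 := MvPolynomial.totalDegree_det_le (A.submatrix s id) (fun p => (s p : ℕ))
      fun p q => hdeg _ _
    have h2 := sum_distinct_le N s hs
    rw [Fintype.card_coe] at h2
    omega
  · rintro z h ⟨k, hk⟩ hh0 hhD hhζ
    let φ := MvPolynomial.eval z
    -- If the cofactor also vanished at `(ζ, 0)`, then `ζ` would be a multiple zero of the line
    -- slice.
    have hsimple : MvPolynomial.eval ![ζ, 0] k ≠ 0 := by
      intro hkζ
      apply hζ'
      have h1 := aeval_planeSlice_X_zero f (v, w, z)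
      rw [hk, map_mul] at h1
      rw [← h1, derivative_mul, eval_add, eval_mul, eval_mul, eval_aeval_X_zero,
        eval_aeval_X_zero, hhζ, hkζ]
      simp
    -- The cofactor does not vanish on the branch at `Y = 0`, so the whole power of `Y` divides the
    -- value of `h`.
    have hα : X ^ (N + 1) ∣ MvPolynomial.aeval ![a.map φ, X] h := by
      have h1 := map_dvd (mapRingHom φ) haN
      rw [coe_mapRingHom, map_eval_genericSlice, hk, map_mul] at h1
      rw [Polynomial.map_pow, map_X] at h1
      refine Polynomial.prime_X.pow_dvd_of_dvd_mul_right _ ?_ h1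
      rw [X_dvd_iff, coeff_zero_eq_eval_zero]
      have h3 : (Polynomial.aeval (0 : K)).comp (MvPolynomial.aeval ![a.map φ, X]) =
          MvPolynomial.aeval ![ζ, 0] := by
        have h4 : (a.map φ).eval 0 = ζ := by
          have h5 := map_dvd (mapRingHom φ) haζ
          simp only [coe_mapRingHom, map_X, Polynomial.map_sub, map_C] at h5
          rw [X_dvd_iff, coeff_zero_eq_eval_zero, eval_sub, sub_eq_zero, eval_C] at h5
          simpa [φ] using h5
        ext1 i
        fin_cases i
        · simpa using h4
        · simp
      have h6 := DFunLike.congr_fun h3 k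
      simp only [AlgHom.comp_apply, Polynomial.coe_aeval_eq_eval,
        MvPolynomial.aeval_eq_eval] at h6
      rw [h6]
      exact hsimple
    have hdet0 : ((A.map φ).submatrix s id).det = 0 := by
      rw [← Matrix.exists_mulVec_eq_zero_iff]
      -- The coefficients of `h` form a nonzero kernel vector of the specialized matrix.
      refine ⟨fun p => h.coeff (pairExponent p), fun h0 => hh0 ?_, ?_⟩
      · ext t
        rw [MvPolynomial.coeff_zero]
        by_contra ht
        obtain ⟨p, hp, rfl⟩ := exists_pairExponent_of_mem_support hhD
          (MvPolynomial.mem_support_iff.mpr ht)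
        exact ht (congrFun h0 ⟨p, hp⟩)
      · ext q
        rw [X_pow_dvd_iff] at hα
        have h1 := hα (s q) (s q).is_lt
        rw [aeval_eq_sum_exponentsLE hhD, finsetSum_coeff] at h1
        rw [Pi.zero_apply, ← h1, Matrix.mulVec, dotProduct]
        refine Finset.sum_congr rfl fun p _ => ?_
        rw [Polynomial.algebraMap_eq, coeff_C_mul, mul_comm]
        congr 1
        simp only [Matrix.submatrix_apply, Matrix.map_apply, A, Matrix.of_apply, id]
        rw [← coeff_map]
        simp
    have h7 : (A.map φ).submatrix s id = φ.mapMatrix (A.submatrix s id) := rfl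
    rw [h7, ← RingHom.map_det] at hdet0
    exact hdet0

end

/-! ### The discriminant of a line slice: good lines -/

section

open Polynomial

variable {K : Type*} [Field K] {m : ℕ}

/-- The restriction to a line with indeterminates for `v` and `w`. -/
noncomputable def universalLineSlice (f : MvPolynomial (Fin (m + 1)) K) :
    (MvPolynomial (Fin (m + 1) ⊕ Fin m) K)[X] :=
  slice f (fun i => C (MvPolynomial.X (Sum.inl i))) (fun i => C (MvPolynomial.X (Sum.inr i)))
    (fun _ => 0) X

/-- The polynomial in `v` and `w` whose nonvanishing ensures that the line slice has full degree and
simple zeros. -/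
noncomputable def lineDiscriminant (f : MvPolynomial (Fin (m + 1)) K) :
    MvPolynomial (Fin (m + 1) ⊕ Fin m) K :=
  (universalLineSlice f).coeff f.totalDegree *
    (universalLineSlice f).resultant (universalLineSlice f).derivative f.totalDegree
      (f.totalDegree - 1)

theorem map_universalLineSlice {B : Type*} [CommRing B] [Algebra K B]
    (f : MvPolynomial (Fin (m + 1)) K) (x : Fin (m + 1) ⊕ Fin m → B) :
    (universalLineSlice f).map (MvPolynomial.aeval x : _ →ₐ[K] B).toRingHom =
      slice f (fun i => C (x (Sum.inl i))) (fun i => C (x (Sum.inr i))) (fun _ => 0) X := by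
  have h1 : (universalLineSlice f).map (MvPolynomial.aeval x : _ →ₐ[K] B).toRingHom =
      mapAlgHom (MvPolynomial.aeval x : _ →ₐ[K] B) (universalLineSlice f) := by
    rw [coe_mapAlgHom]
    rfl
  rw [h1, universalLineSlice]
  refine (AlgHom.map_slice (B := (MvPolynomial (Fin (m + 1) ⊕ Fin m) K)[X])
    (B' := B[X]) _ _ _ _ _ _).trans ?_
  congr 1
  · ext1 i; simp
  · ext1 i; simp
  · ext1 i; simp
  · simp

theorem totalDegree_coeff_universalLineSlice_le (f : MvPolynomial (Fin (m + 1)) K) (k : ℕ) :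
    ((universalLineSlice f).coeff k).totalDegree ≤ f.totalDegree := by
  let W : ℕ → Submodule K (MvPolynomial (Fin (m + 1) ⊕ Fin m) K)[X] := fun e =>
    { carrier := {p | ∀ k, (p.coeff k).totalDegree ≤ e}
      zero_mem' := by simp
      add_mem' := fun {a b} ha hb k => by
        rw [coeff_add]
        exact (MvPolynomial.totalDegree_add _ _).trans (max_le (ha k) (hb k))
      smul_mem' := fun c a ha k => by
        rw [coeff_smul]
        exact (MvPolynomial.totalDegree_smul_le _ _).trans (ha k) }
  have hW : ∀ e p, p ∈ W e ↔ ∀ k, (p.coeff k).totalDegree ≤ e := fun _ _ => Iff.rfl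
  refine (slice_mem_filtration W ?_ ?_ ?_ f ?_ ?_ ?_ ?_ : universalLineSlice f ∈ _) k
  · intro k
    rw [coeff_one]
    split_ifs <;> simp
  · intro a b hab p hp k
    exact (hp k).trans hab
  · intro a b p q hp hq k
    rw [coeff_mul]
    refine MvPolynomial.totalDegree_finsetSum_le fun x _ => ?_
    exact (MvPolynomial.totalDegree_mul _ _).trans (Nat.add_le_add (hp _) (hq _))
  all_goals simp only [hW]
  · intro i k
    rw [coeff_C]
    split_ifs <;> simp
  · intro i k
    rw [coeff_C_mul, coeff_X]
    split_ifs <;> simp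
  · simp
  · intro k
    rw [coeff_X]
    split_ifs <;> simp

/-- The leading coefficient contributes `d`, and the Sylvester matrix has size `2 * d - 1` with
entries of degree at most `d`. -/
theorem totalDegree_lineDiscriminant_le (f : MvPolynomial (Fin (m + 1)) K)
    (hd : 0 < f.totalDegree) :
    (lineDiscriminant f).totalDegree ≤ 2 * f.totalDegree ^ 2 := by
  have hG := totalDegree_coeff_universalLineSlice_le f
  refine (MvPolynomial.totalDegree_mul _ _).trans ?_
  set G := universalLineSlice f
  set d := f.totalDegree
  have hres : (G.resultant (derivative G) d (d - 1)).totalDegree ≤ (d + (d - 1)) * d := by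
    refine (MvPolynomial.totalDegree_det_le _ (fun _ => d) fun i j => ?_).trans (by simp)
    induction j using Fin.addCases with
    | left j =>
      simp only [sylvester, Matrix.of_apply, Fin.addCases_left]
      split_ifs
      · rw [coeff_derivative]
        refine (MvPolynomial.totalDegree_mul _ _).trans ?_
        have : ((i - j : ℕ) + 1 : MvPolynomial (Fin (m + 1) ⊕ Fin m) K) =
            MvPolynomial.C ((i - j : ℕ) + 1 : K) := by simp
        rw [this, MvPolynomial.totalDegree_C]
        exact hG _
      · simp
    | right j =>
      simp only [sylvester, Matrix.of_apply, Fin.addCases_right]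
      split_ifs
      · exact hG _
      · simp
  refine (Nat.add_le_add (hG d) hres).trans (le_of_eq ?_)
  obtain ⟨e, he⟩ : ∃ e, d = e + 1 := ⟨d - 1, by omega⟩
  rw [he, Nat.add_sub_cancel]
  ring

/-- The formal resultant of a polynomial of full degree and its derivative vanishes exactly if they
are not coprime. -/
theorem resultant_derivative_ne_zero_iff {L : Type*} [Field L] {p : L[X]} {d : ℕ}
    (hp : p.natDegree ≤ d) (hd : p.coeff d ≠ 0) :
    p.resultant p.derivative d (d - 1) ≠ 0 ↔ p.Separable := by
  have hnat : p.natDegree = d := le_antisymm hp (le_natDegree_of_ne_zero hd)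
  have hder : p.derivative.natDegree ≤ d - 1 := by
    rw [← hnat]
    exact natDegree_derivative_le p
  -- In positive characteristic the derivative can have degree below `d - 1`; the formal resultant
  -- then only gains powers of the leading coefficient of `p`, up to sign.
  obtain ⟨k, hk⟩ := Nat.exists_eq_add_of_le hder
  rw [hk, resultant_add_right_deg _ _ _ _ _ le_rfl, mul_ne_zero_iff, Ne, Ne, ← hnat,
    resultant_eq_zero_iff, Polynomial.Separable]
  rw [← hnat] at hd
  have hp0 : p ≠ 0 := by
    rintro rfl
    simp at hd
  simp [hp0]

theorem eval_lineDiscriminant (f : MvPolynomial (Fin (m + 1)) K) (v : Fin (m + 1) → K)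
    (w : Fin m → K) :
    MvPolynomial.eval (Sum.elim v w) (lineDiscriminant f) =
      (lineSlice f v w).coeff f.totalDegree * (lineSlice f v w).resultant
        (lineSlice f v w).derivative f.totalDegree (f.totalDegree - 1) := by
  have h1 := map_universalLineSlice f (Sum.elim v w)
  have h2 : (slice f (fun i => C (Sum.elim v w (Sum.inl i)))
      (fun i => C (Sum.elim v w (Sum.inr i))) (fun _ => 0) X : K[X]) = lineSlice f v w := rfl
  rw [h2] at h1
  have h3 : (MvPolynomial.eval (Sum.elim v w) (lineDiscriminant f)) =
    (MvPolynomial.aeval (Sum.elim v w) : _ →ₐ[K] K).toRingHom (lineDiscriminant f) := rfl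
  rw [h3, lineDiscriminant, map_mul, ← resultant_map_map, ← derivative_map, ← coeff_map, h1]

theorem lineSlice_of_eval_ne_zero {f : MvPolynomial (Fin (m + 1)) K} {v : Fin (m + 1) → K}
    {w : Fin m → K} (h : MvPolynomial.eval (Sum.elim v w) (lineDiscriminant f) ≠ 0) :
    (lineSlice f v w).coeff f.totalDegree ≠ 0 ∧ (lineSlice f v w).Separable := by
  rw [eval_lineDiscriminant, mul_ne_zero_iff] at h
  exact ⟨h.1, (resultant_derivative_ne_zero_iff (natDegree_lineSlice_le f v w) h.1).mp h.2⟩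

/-- Chain rule: differentiating along the line is the directional derivative of `f` in direction
`(1, w)`. -/
theorem derivative_finSuccEquiv_shear (v : Fin (m + 1) → K) (w : Fin m → K)
    (f : MvPolynomial (Fin (m + 1)) K) :
    derivative (MvPolynomial.finSuccEquiv K m (shear v w f)) =
      MvPolynomial.finSuccEquiv K m (shear v w (MvPolynomial.pderiv 0 f +
        ∑ i : Fin m, MvPolynomial.C (w i) * MvPolynomial.pderiv i.succ f)) := by
  let θ : MvPolynomial (Fin (m + 1)) K →+* (MvPolynomial (Fin m) K)[X] :=
    (MvPolynomial.finSuccEquiv K m : _ →+* (MvPolynomial (Fin m) K)[X]).comp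
      (shear v w : MvPolynomial (Fin (m + 1)) K →+* MvPolynomial (Fin (m + 1)) K)
  have hθC : ∀ c, θ (MvPolynomial.C c) = C (MvPolynomial.C c) := by
    intro c
    change MvPolynomial.finSuccEquiv K m (shear v w (MvPolynomial.C c)) = _
    rw [finSuccEquiv_shear]
    simp [slice, MvPolynomial.algHom_C, Polynomial.algebraMap_apply]
  have hθ0 : θ (MvPolynomial.X 0) = X + C (MvPolynomial.C (v 0)) := by
    change MvPolynomial.finSuccEquiv K m (shear v w (MvPolynomial.X 0)) = _
    rw [finSuccEquiv_shear]
    simp [slice]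
  have hθs : ∀ i : Fin m, θ (MvPolynomial.X i.succ) = C (MvPolynomial.C (w i)) * X +
      C (MvPolynomial.X i) + C (MvPolynomial.C (v i.succ)) := by
    intro i
    change MvPolynomial.finSuccEquiv K m (shear v w (MvPolynomial.X i.succ)) = _
    rw [finSuccEquiv_shear]
    simp [slice]
  change derivative (θ f) = θ _
  induction f using MvPolynomial.induction_on with
  | C a => simp [hθC]
  | add p q hp hq =>
    rw [map_add, map_add, hp, hq, ← map_add]
    congr 1
    simp only [map_add, mul_add, Finset.sum_add_distrib]
    ring
  | mul_X p i hp =>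
    rw [map_mul, derivative_mul, hp]
    simp only [MvPolynomial.pderiv_mul, mul_add, Finset.sum_add_distrib, map_add, map_mul, map_sum,
      hθC]
    have hX : derivative (θ (MvPolynomial.X i)) =
        θ (MvPolynomial.pderiv 0 (MvPolynomial.X i)) +
        ∑ j : Fin m, C (MvPolynomial.C (w j)) *
          θ (MvPolynomial.pderiv j.succ (MvPolynomial.X i)) := by
      refine Fin.cases ?_ (fun i => ?_) i
      · rw [hθ0]
        simp [MvPolynomial.pderiv_X, (Fin.succ_ne_zero _).symm]
      · rw [hθs]
        simp [MvPolynomial.pderiv_X, Pi.single_apply, Fin.succ_ne_zero, apply_ite θ]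
    rw [hX, add_mul, mul_add, Finset.sum_mul, Finset.mul_sum]
    simp only [mul_assoc, mul_left_comm, add_assoc]
    rw [add_left_comm (∑ i : Fin m, _) (θ p * _)]

theorem coeff_lineSlice_zero (f : MvPolynomial (Fin (m + 1)) K) (w : Fin m → K) (n : ℕ) :
    (lineSlice f 0 w).coeff n =
      MvPolynomial.eval (Fin.cons 1 w : Fin (m + 1) → K) (MvPolynomial.homogeneousComponent n f) := by
  have h1 : lineSlice f 0 w =
      MvPolynomial.aeval (fun i => C ((Fin.cons 1 w : Fin (m + 1) → K) i) * X) f := by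
    rw [lineSlice, slice]
    congr 2
    ext1 i
    refine Fin.cases ?_ (fun i => ?_) i <;> simp
  rw [h1, MvPolynomial.aeval_def, MvPolynomial.eval₂_eq', finsetSum_coeff,
    MvPolynomial.homogeneousComponent_apply, map_sum, Finset.sum_filter]
  refine Finset.sum_congr rfl fun s _ => ?_
  simp only [mul_pow, Finset.prod_mul_distrib, Finset.prod_pow_eq_pow_sum, ← C_pow,
    Polynomial.algebraMap_eq]
  rw [← map_prod, ← mul_assoc, ← C_mul, coeff_C_mul, coeff_X_pow, Finsupp.degree_eq_sum]
  split_ifs with h2 h3 h3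
  · rw [MvPolynomial.eval_monomial, Finsupp.prod_fintype _ _ (by simp)]
    simp
  · exact absurd h2.symm h3
  · exact absurd h3.symm h2
  · simp

theorem eval_smul_homogeneousComponent {σ : Type*} (f : MvPolynomial σ K) (n : ℕ) (c : K)
    (x : σ → K) :
    MvPolynomial.eval (c • x) (MvPolynomial.homogeneousComponent n f) =
      c ^ n * MvPolynomial.eval x (MvPolynomial.homogeneousComponent n f) := by
  rw [MvPolynomial.homogeneousComponent_apply, map_sum, map_sum, Finset.mul_sum]
  refine Finset.sum_congr rfl fun s hs => ?_
  rw [← (Finset.mem_filter.mp hs).2]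
  simp only [MvPolynomial.eval_monomial, Pi.smul_apply, smul_eq_mul, mul_pow, Finsupp.prod,
    Finset.prod_mul_distrib, Finset.prod_pow_eq_pow_sum, Finsupp.degree_apply]
  ring

/-- Both conditions are open and nonempty in the direction: the first is nonvanishing of the top
homogeneous part, the second nonvanishing of one coefficient of the directional derivative. -/
theorem exists_transversal_direction [Infinite K] {f : MvPolynomial (Fin (m + 1)) K} (hf : f ≠ 0)
    (hder : ∃ i, MvPolynomial.pderiv i f ≠ 0) :
    ∃ w : Fin m → K, (lineSlice f 0 w).coeff f.totalDegree ≠ 0 ∧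
      MvPolynomial.pderiv 0 f +
        ∑ i : Fin m, MvPolynomial.C (w i) * MvPolynomial.pderiv i.succ f ≠ 0 := by
  classical
  obtain ⟨i₀, hi₀⟩ := hder
  obtain ⟨s, hs⟩ := MvPolynomial.ne_zero_iff.mp hi₀
  -- `Q(a)` is the coefficient at `s` of the derivative of `f` in direction `a`.
  let Q : MvPolynomial (Fin (m + 1)) K :=
    ∑ j, MvPolynomial.C (MvPolynomial.coeff s (MvPolynomial.pderiv j f)) * MvPolynomial.X j
  have hQ : Q ≠ 0 := by
    intro h0
    have := congrArg (MvPolynomial.eval (Pi.single i₀ 1)) h0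
    simp only [Q, map_sum, map_mul, MvPolynomial.eval_C, MvPolynomial.eval_X, map_zero,
      Pi.single_apply, mul_ite, mul_one, mul_zero, Finset.sum_ite_eq', Finset.mem_univ,
      if_true] at this
    exact hs this
  have htop : MvPolynomial.homogeneousComponent f.totalDegree f ≠ 0 := by
    obtain ⟨t, ht, htd⟩ := Finset.exists_mem_eq_sup f.support
      (MvPolynomial.support_nonempty.mpr hf) (fun s => s.sum fun _ e => e)
    intro h0
    have := congrArg (MvPolynomial.coeff t) h0
    rw [MvPolynomial.coeff_homogeneousComponent, if_pos, MvPolynomial.coeff_zero] at this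
    · exact MvPolynomial.mem_support_iff.mp ht this
    · exact htd.symm
  -- The factor `X 0` makes it possible to scale `a` to first coordinate `1`.
  obtain ⟨a, ha⟩ : ∃ a, MvPolynomial.eval a
      (MvPolynomial.homogeneousComponent f.totalDegree f * MvPolynomial.X 0 * Q) ≠ 0 := by
    by_contra! h
    exact mul_ne_zero (mul_ne_zero htop (MvPolynomial.X_ne_zero 0)) hQ
      (MvPolynomial.funext fun x => by rw [h x, map_zero])
  rw [map_mul, map_mul, MvPolynomial.eval_X, mul_ne_zero_iff, mul_ne_zero_iff] at ha
  obtain ⟨⟨ha1, ha2⟩, ha3⟩ := ha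
  refine ⟨fun i => a i.succ / a 0, ?_, ?_⟩
  · rw [coeff_lineSlice_zero]
    intro h0
    apply ha1
    have h1 : a = a 0 • (Fin.cons 1 (fun i : Fin m => a i.succ / a 0) : Fin (m + 1) → K) := by
      ext i
      refine Fin.cases ?_ (fun i => ?_) i
      · simp
      · simp [mul_div_cancel₀ _ ha2]
    rw [h1, eval_smul_homogeneousComponent, h0, mul_zero]
  · intro h0
    apply ha3
    have h1 := congrArg (MvPolynomial.coeff s) h0
    rw [MvPolynomial.coeff_add, MvPolynomial.coeff_sum, MvPolynomial.coeff_zero] at h1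
    simp only [MvPolynomial.coeff_C_mul] at h1
    simp only [Q, map_sum, map_mul, MvPolynomial.eval_C, MvPolynomial.eval_X]
    have h2 := congrArg (a 0 * ·) h1
    simp only [mul_add, mul_zero, Finset.mul_sum] at h2
    rw [Fin.sum_univ_succ, ← h2]
    congr 1
    · exact mul_comm _ _
    · refine Finset.sum_congr rfl fun i _ => ?_
      field_simp

/-- It suffices that one specialization is nonzero. The generic slice in a transversal direction is
irreducible with nonzero derivative in `X`, hence separable over the fraction field. -/
theorem lineDiscriminant_ne_zero [Infinite K] {f : MvPolynomial (Fin (m + 1)) K}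
    (hf : Irreducible f) (hder : ∃ i, MvPolynomial.pderiv i f ≠ 0) : lineDiscriminant f ≠ 0 := by
  obtain ⟨w, hw1, hw2⟩ := exists_transversal_direction hf.ne_zero hder
  set G := genericSlice f 0 w with hG
  let φ := algebraMap (MvPolynomial (Fin m) K)[X] (FractionRing (MvPolynomial (Fin m) K)[X])
  have hφ : Function.Injective φ := IsFractionRing.injective _ _
  have hirr : Irreducible (G.map φ) := irreducible_map_genericSlice hf 0 w hw1
  have hGd : G.natDegree ≤ f.totalDegree := natDegree_le_of_mem_bidegreeLE (genericSlice_mem f 0 w)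
  have hcoeff : (G.map φ).coeff f.totalDegree ≠ 0 := by
    rw [coeff_map, hG, genericSlice_coeff]
    simpa [map_ne_zero_iff _ hφ] using hw1
  have hder' : G.derivative ≠ 0 := by
    intro h0
    have h1 := congrArg (Polynomial.map (evalRingHom 1)) h0
    rw [← derivative_map, hG, genericSlice_map_eval_one, Polynomial.map_zero,
      ← finSuccEquiv_shear, derivative_finSuccEquiv_shear] at h1
    simp only [EmbeddingLike.map_eq_zero_iff] at h1
    exact hw2 h1
  have hsep : (G.map φ).Separable := by
    rw [separable_iff_derivative_ne_zero hirr, derivative_map]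
    exact (Polynomial.map_ne_zero_iff hφ).mpr hder'
  have hres := (resultant_derivative_ne_zero_iff (natDegree_map_le.trans hGd) hcoeff).mpr hsep
  -- The generic slice is the line slice with base point `(0, z₂ Y, …, zₙ Y)`.
  let x : Fin (m + 1) ⊕ Fin m → (MvPolynomial (Fin m) K)[X] :=
    Sum.elim (Fin.cons 0 fun i => C (MvPolynomial.X i) * X) fun i => C (MvPolynomial.C (w i))
  have hx : (universalLineSlice f).map (MvPolynomial.aeval x : _ →ₐ[K] _).toRingHom = G := by
    rw [map_universalLineSlice, hG, genericSlice, slice, slice]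
    congr 2
    ext1 i
    refine Fin.cases ?_ (fun i => ?_) i <;> simp [x]
  intro h0
  have h1 := congrArg (φ.comp (MvPolynomial.aeval x : _ →ₐ[K] _).toRingHom) h0
  rw [lineDiscriminant, map_mul, ← resultant_map_map, ← derivative_map, ← coeff_map,
    ← Polynomial.map_map, hx, map_zero] at h1
  exact mul_ne_zero hcoeff hres h1

end

/-! ### Obstructions to irreducibility and to factors of low degree -/

section

open Polynomial

theorem MvPolynomial.totalDegree_pos_of_not_isUnit {σ K : Type*} [Field K] {p : MvPolynomial σ K}
    (hp : p ≠ 0) (hu : ¬ IsUnit p) : 0 < p.totalDegree := by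
  by_contra! h
  have h1 := totalDegree_eq_zero_iff_eq_C.mp (Nat.le_zero.mp h)
  rw [h1] at hp hu
  refine hu ((IsUnit.mk0 _ fun h0 => hp ?_).map C)
  rw [h0, map_zero]

/-- The degree bound for a maximal minor of the matrix of coefficients of the monomials of degree at
most `D` on a branch: the sum of the largest weights that distinct rows can have. -/
def minorDegree (d D : ℕ) : ℕ :=
  (2 * ((exponentsLE D).card * (d * D)) - (exponentsLE D).card * ((exponentsLE D).card - 1)) / 2

theorem cast_minorDegree_le {d D : ℕ} (hD : D < d) :
    (minorDegree d D : ℚ) ≤ 1 / 8 * (-(D : ℚ) ^ 4 + 4 * (D : ℚ) ^ 3 * d - 6 * (D : ℚ) ^ 3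
      + 12 * (D : ℚ) ^ 2 * d - 11 * (D : ℚ) ^ 2 + 8 * (D : ℚ) * d - 6 * (D : ℚ)) := by
  have hM := card_exponentsLE D
  rw [minorDegree]
  set M := (exponentsLE D).card
  -- This shows that the truncated subtraction in `minorDegree` is a true one.
  have hM1 : M - 1 ≤ 2 * (d * D) := by
    have : D * (D + 3) ≤ D * (4 * d) := Nat.mul_le_mul_left _ (by omega)
    have h2 : 2 * M = D * (D + 3) + 2 := by rw [hM]; ring
    have h3 : D * (4 * d) = 4 * (d * D) := by ring
    omega
  have hle : M * (M - 1) ≤ 2 * (M * (d * D)) := by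
    calc M * (M - 1) ≤ M * (2 * (d * D)) := Nat.mul_le_mul_left _ hM1
      _ = 2 * (M * (d * D)) := by ring
  have hb : (2 * (M * (d * D)) - M * (M - 1)) / 2 * 2 + M * (M - 1) ≤ 2 * (M * (d * D)) := by
    omega
  have hpos : 1 ≤ M := by
    have : 2 * 1 ≤ 2 * M := by rw [hM]; nlinarith
    omega
  have hb' : (((2 * (M * (d * D)) - M * (M - 1)) / 2 : ℕ) : ℚ) * 2 + M * (M - 1) ≤
      2 * (M * (d * D)) := by
    have := (Nat.cast_le (α := ℚ)).mpr hb
    push_cast [Nat.cast_sub hpos] at this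
    exact this
  have hM' : (M : ℚ) = (D + 1) * (D + 2) / 2 := by
    have : (2 * M : ℚ) = (D + 1) * (D + 2) := by exact_mod_cast hM
    linarith
  generalize ((2 * (M * (d * D)) - M * (M - 1)) / 2 : ℕ) = b at hb' ⊢
  rw [hM'] at hb'
  nlinarith

variable {K : Type*} [Field K] {m : ℕ}

theorem eval_planeSlice_zero (f : MvPolynomial (Fin (m + 1)) K) (t : SliceParam K m) (ζ : K) :
    MvPolynomial.eval ![ζ, 0] (planeSlice f t) = (lineSlice f t.1 t.2.1).eval ζ := by
  rw [← eval_aeval_X_zero, aeval_planeSlice_X_zero]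

/-- The planar slices through a good line that are reducible correspond to zeros of a nonzero
polynomial in `z`. -/
theorem exists_polynomial_of_reducible [IsAlgClosed K] {f : MvPolynomial (Fin (m + 1)) K}
    (hf : Irreducible f) (hd : 0 < f.totalDegree) {v : Fin (m + 1) → K} {w : Fin m → K}
    (h : MvPolynomial.eval (Sum.elim v w) (lineDiscriminant f) ≠ 0) :
    ∃ Δ : MvPolynomial (Fin m) K, Δ ≠ 0 ∧
      Δ.totalDegree ≤ minorDegree f.totalDegree (f.totalDegree - 1) ∧
      ∀ z : Fin m → K, ¬ Irreducible (planeSlice f (v, w, z)) → MvPolynomial.eval z Δ = 0 := by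
  obtain ⟨hlead, hsep⟩ := lineSlice_of_eval_ne_zero h
  have hnat : (lineSlice f v w).natDegree = f.totalDegree :=
    le_antisymm (natDegree_lineSlice_le f v w) (le_natDegree_of_ne_zero hlead)
  have hne : lineSlice f v w ≠ 0 := by
    intro h0
    rw [h0, natDegree_zero] at hnat
    omega
  obtain ⟨ζ, hζ⟩ := IsAlgClosed.exists_root (lineSlice f v w)
    (by rw [degree_eq_natDegree hne, hnat]; exact_mod_cast hd.ne')
  have hζ' : (lineSlice f v w).derivative.eval ζ ≠ 0 := by
    have := hsep.aeval_derivative_ne_zero (x := ζ) (by simpa using hζ)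
    simpa using this
  obtain ⟨Δ, hΔ0, hΔd, hΔ⟩ := exists_polynomial_of_simple_zero hf v w hlead hζ hζ'
    (D := f.totalDegree - 1) (by omega)
  refine ⟨Δ, hΔ0, ?_, fun z hz => ?_⟩
  · rw [minorDegree]
    omega
  set g := planeSlice f (v, w, z) with hg
  have hgX := aeval_planeSlice_X_zero f (v, w, z)
  have hg0 : g ≠ 0 := by
    intro h0
    rw [← hg, h0, map_zero] at hgX
    exact hne hgX.symm
  have hgu : ¬ IsUnit g := by
    intro hu
    have := hu.map (MvPolynomial.aeval ![X, (0 : K[X])])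
    rw [hg, hgX] at this
    have := natDegree_eq_zero_of_isUnit this
    simp only at this
    omega
  rw [irreducible_iff] at hz
  push Not at hz
  obtain ⟨p, q, hpq, hp, hq⟩ := hz hgu
  have hp0 : p ≠ 0 := by rintro rfl; simp [hg0] at hpq
  have hq0 : q ≠ 0 := by rintro rfl; simp [hg0] at hpq
  have hp1 := MvPolynomial.totalDegree_pos_of_not_isUnit hp0 hp
  have hq1 := MvPolynomial.totalDegree_pos_of_not_isUnit hq0 hq
  have hsum := totalDegree_planeSlice_le f (v, w, z)
  rw [← hg, hpq, MvPolynomial.totalDegree_mul_of_isDomain hp0 hq0] at hsum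
  have hev := eval_planeSlice_zero f (v, w, z) ζ
  rw [← hg, hpq, map_mul] at hev
  -- One of the two factors passes through `(ζ, 0)`. Both are nonconstant with degrees summing to at
  -- most `d`, so either one has degree at most `d - 1`.
  rcases mul_eq_zero.mp (hev.trans hζ) with h1 | h1
  · exact hΔ z p (Dvd.intro q hpq.symm) hp0 (by omega) h1
  · exact hΔ z q (Dvd.intro_left p hpq.symm) hq0 (by omega) h1

/-- The planar slices through a good line that have a factor of degree at most `D` correspond to zeros
of a nonzero polynomial in `z`. -/
theorem exists_polynomial_of_factor [IsAlgClosed K] {f : MvPolynomial (Fin (m + 1)) K}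
    (hf : Irreducible f) {v : Fin (m + 1) → K} {w : Fin m → K}
    (h : MvPolynomial.eval (Sum.elim v w) (lineDiscriminant f) ≠ 0) {D : ℕ}
    (hD : D < f.totalDegree) :
    ∃ Δ : MvPolynomial (Fin m) K, Δ ≠ 0 ∧
      Δ.totalDegree ≤ f.totalDegree * minorDegree f.totalDegree D ∧
      ∀ z : Fin m → K, (∃ p, Irreducible p ∧ p.totalDegree ≤ D ∧ p ∣ planeSlice f (v, w, z)) →
        MvPolynomial.eval z Δ = 0 := by
  classical
  obtain ⟨hlead, hsep⟩ := lineSlice_of_eval_ne_zero h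
  have hnat : (lineSlice f v w).natDegree = f.totalDegree :=
    le_antisymm (natDegree_lineSlice_le f v w) (le_natDegree_of_ne_zero hlead)
  have hne : lineSlice f v w ≠ 0 := by
    intro h0
    rw [h0, natDegree_zero] at hnat
    omega
  have hex : ∀ ζ : K, ∃ Δ : MvPolynomial (Fin m) K, Δ ≠ 0 ∧
      Δ.totalDegree ≤ minorDegree f.totalDegree D ∧
      ((lineSlice f v w).eval ζ = 0 → ∀ (z : Fin m → K) (p : MvPolynomial (Fin 2) K),
        p ∣ planeSlice f (v, w, z) → p ≠ 0 → p.totalDegree ≤ D →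
        MvPolynomial.eval ![ζ, 0] p = 0 → MvPolynomial.eval z Δ = 0) := by
    intro ζ
    by_cases hζ : (lineSlice f v w).eval ζ = 0
    · have hζ' : (lineSlice f v w).derivative.eval ζ ≠ 0 := by
        have := hsep.aeval_derivative_ne_zero (x := ζ) (by simpa using hζ)
        simpa using this
      obtain ⟨Δ, hΔ0, hΔd, hΔ⟩ := exists_polynomial_of_simple_zero hf v w hlead hζ hζ' hD
      refine ⟨Δ, hΔ0, ?_, fun _ => hΔ⟩
      rw [minorDegree]
      omega
    · exact ⟨1, one_ne_zero, by simp, fun h => absurd h hζ⟩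
  choose Δ hΔ0 hΔd hΔ using hex
  refine ⟨∏ ζ ∈ (lineSlice f v w).roots.toFinset, Δ ζ, Finset.prod_ne_zero_iff.mpr fun ζ _ => hΔ0 ζ,
    ?_, ?_⟩
  · refine (MvPolynomial.totalDegree_finsetProd _ _).trans ?_
    refine (Finset.sum_le_card_nsmul _ _ _ fun ζ _ => hΔd ζ).trans ?_
    rw [smul_eq_mul]
    refine Nat.mul_le_mul_right _ ?_
    rw [← hnat]
    exact (Multiset.toFinset_card_le _).trans (card_roots' _)
  · rintro z ⟨p, hp, hpD, q, hpq⟩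
    have hgX := aeval_planeSlice_X_zero f (v, w, z)
    rw [hpq, map_mul] at hgX
    simp only at hgX
    have hq0 : q ≠ 0 := by
      rintro rfl
      rw [map_zero, mul_zero] at hgX
      exact hne hgX.symm
    have hle : ∀ b : MvPolynomial (Fin 2) K,
        (MvPolynomial.aeval ![X, (0 : K[X])] b).natDegree ≤ b.totalDegree := by
      intro b
      have := MvPolynomial.aeval_natDegree_le (n := 1) b le_rfl ![X, (0 : K[X])] (fun i => by
        fin_cases i <;> simp)
      simpa using this
    have hsum := totalDegree_planeSlice_le f (v, w, z)
    rw [hpq, MvPolynomial.totalDegree_mul_of_isDomain hp.ne_zero hq0] at hsum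
    -- Restricted to `Y = 0`, the degrees of `p` and `q` sum to `d`, while their total degrees sum
    -- to at most `d`. So neither loses degree, and `p` has a zero on the line.
    have hmul : (MvPolynomial.aeval ![X, (0 : K[X])] p).natDegree +
        (MvPolynomial.aeval ![X, (0 : K[X])] q).natDegree = f.totalDegree := by
      rw [← hnat, ← hgX, natDegree_mul]
      · exact left_ne_zero_of_mul (hgX.trans_ne hne)
      · exact right_ne_zero_of_mul (hgX.trans_ne hne)
    have hp1 := MvPolynomial.totalDegree_pos_of_not_isUnit hp.ne_zero hp.not_isUnit
    have hpX : (MvPolynomial.aeval ![X, (0 : K[X])] p).natDegree ≠ 0 := by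
      have := hle p
      have := hle q
      omega
    obtain ⟨ζ, hζ⟩ := IsAlgClosed.exists_root (MvPolynomial.aeval ![X, (0 : K[X])] p)
      (fun h0 => hpX (natDegree_eq_of_degree_eq_some h0))
    have hζ' : (lineSlice f v w).eval ζ = 0 := by
      rw [← hgX, eval_mul, hζ.eq_zero, zero_mul]
    rw [map_prod]
    refine Finset.prod_eq_zero (i := ζ) ?_ ?_
    · rw [Multiset.mem_toFinset, mem_roots hne]
      exact hζ'
    · refine hΔ ζ hζ' z p (Dvd.intro q hpq.symm) hp.ne_zero hpD ?_
      rw [← eval_aeval_X_zero]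
      exact hζ

end

/-! ### Counting and conclusion -/

/-- Counting parameter tuples: outside the zeros of a polynomial in `(v, w)`, each fibre is contained
in the zeros of a polynomial in `z`. -/
theorem ncard_sliceParam_le {F K : Type*} [Field F] [Fintype F] [Field K] {m : ℕ} (φ : F →+* K)
    (P : SliceParam F m → Prop) (E : MvPolynomial (Fin (m + 1) ⊕ Fin m) K) (hE : E ≠ 0) (b : ℕ)
    (h : ∀ (v : Fin (m + 1) → F) (w : Fin m → F),
      MvPolynomial.eval (Sum.elim (φ ∘ v) (φ ∘ w)) E ≠ 0 →
      ∃ Δ : MvPolynomial (Fin m) K, Δ ≠ 0 ∧ Δ.totalDegree ≤ b ∧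
        ∀ z : Fin m → F, P (v, w, z) → MvPolynomial.eval (φ ∘ z) Δ = 0) :
    {t | P t}.ncard ≤ (E.totalDegree + b) * Fintype.card F ^ (3 * m) := by
  classical
  set q := Fintype.card F with hq
  have hq0 : 0 < q := Fintype.card_pos
  let Z : Finset ((Fin (m + 1) → F) × (Fin m → F)) :=
    Finset.univ.filter fun y => MvPolynomial.eval (Sum.elim (φ ∘ y.1) (φ ∘ y.2)) E = 0
  have hZ : Z.card * q ≤ E.totalDegree * q ^ (2 * m + 1) := by
    have h1 := MvPolynomial.card_zeros_mul_le φ E hE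
    rw [Fintype.card_sum, Fintype.card_fin, Fintype.card_fin,
      show m + 1 + m = 2 * m + 1 by ring] at h1
    refine le_trans (Nat.mul_le_mul_right _ ?_) h1
    rw [← Set.ncard_coe_finset]
    refine Set.ncard_le_ncard_of_injOn (fun y => Sum.elim y.1 y.2) ?_ ?_ (Set.toFinite _)
    · intro y hy
      have hy' := (Finset.mem_filter.mp (Finset.mem_coe.mp hy)).2
      rwa [Set.mem_ofPred_eq, Sum.comp_elim]
    · intro y _ y' _ hyy
      exact Prod.ext (funext fun i => congrFun hyy (Sum.inl i))
        (funext fun i => congrFun hyy (Sum.inr i))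
  let T : (Fin (m + 1) → F) × (Fin m → F) → Finset (Fin m → F) := fun y =>
    Finset.univ.filter fun z => P (y.1, y.2, z)
  have hcard : {t | P t}.ncard = ∑ y, (T y).card := by
    rw [← Finset.card_sigma, ← Set.ncard_coe_finset]
    refine Set.ncard_congr (fun t _ => ⟨(t.1, t.2.1), t.2.2⟩) ?_ ?_ ?_
    · rintro ⟨v, w, z⟩ ht
      simpa [T] using ht
    · rintro ⟨v, w, z⟩ ⟨v', w', z'⟩ _ _ heq
      simp only [Sigma.mk.injEq, Prod.mk.injEq, heq_eq_eq] at heq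
      obtain ⟨⟨rfl, rfl⟩, rfl⟩ := heq
      rfl
    · rintro ⟨⟨v, w⟩, z⟩ hy
      exact ⟨(v, w, z), by simpa [T] using hy, rfl⟩
  -- Multiplying by `q` avoids the exponent `m - 1`, so that `m = 0` needs no separate treatment.
  -- Over a zero of `E` the whole fibre is counted.
  have hT : ∀ y, (T y).card * q ≤ (if y ∈ Z then q ^ (m + 1) else 0) + b * q ^ m := by
    intro y
    split_ifs with hy
    · refine le_trans ?_ (Nat.le_add_right _ _)
      rw [pow_succ]
      refine Nat.mul_le_mul_right _ ((Finset.card_le_univ _).trans (le_of_eq ?_))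
      rw [Fintype.card_fun, Fintype.card_fin]
    · rw [zero_add]
      obtain ⟨Δ, hΔ0, hΔd, hΔ⟩ := h y.1 y.2 fun h0 =>
        hy (Finset.mem_filter.mpr ⟨Finset.mem_univ _, h0⟩)
      have h1 := MvPolynomial.card_zeros_mul_le φ Δ hΔ0
      rw [Fintype.card_fin] at h1
      refine le_trans (Nat.mul_le_mul_right _ ?_) (h1.trans (Nat.mul_le_mul_right _ hΔd))
      rw [← Set.ncard_coe_finset]
      refine Set.ncard_le_ncard (fun z hz => ?_) (Set.toFinite _)
      exact hΔ z (Finset.mem_filter.mp (Finset.mem_coe.mp hz)).2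
  refine Nat.le_of_mul_le_mul_right ?_ hq0
  rw [hcard, Finset.sum_mul]
  refine (Finset.sum_le_sum fun y _ => hT y).trans ?_
  rw [Finset.sum_add_distrib, Finset.sum_ite_mem, Finset.univ_inter, Finset.sum_const,
    Finset.sum_const, Finset.card_univ, Fintype.card_prod, Fintype.card_fun, Fintype.card_fun,
    Fintype.card_fin, Fintype.card_fin, smul_eq_mul, smul_eq_mul, ← hq]
  calc Z.card * q ^ (m + 1) + q ^ (m + 1) * q ^ m * (b * q ^ m)
      = Z.card * q * q ^ m + b * q ^ (3 * m + 1) := by ring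
    _ ≤ E.totalDegree * q ^ (2 * m + 1) * q ^ m + b * q ^ (3 * m + 1) :=
        Nat.add_le_add_right (Nat.mul_le_mul_right _ hZ) _
    _ = (E.totalDegree + b) * q ^ (3 * m) * q := by ring

/-- With `n = m + 1` the exponent `3 * n - 3` is `3 * m`. The constants are `2 * d ^ 2` for bad
lines plus `minorDegree d (d - 1)` in (i) and `d * minorDegree d D` in (ii). -/
theorem theoremA {F : Type*} [Field F] [Fintype F] (m d : ℕ)
    (f : MvPolynomial (Fin (m + 1)) F) (hf : AbsolutelyIrreducible f) (hd : f.totalDegree = d) :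
    (({t : SliceParam F m | ¬ AbsolutelyIrreducible (planeSlice f t)}.ncard : ℚ) ≤
        1 / 8 * (3 * (d : ℚ) ^ 4 - 2 * (d : ℚ) ^ 3 + 13 * (d : ℚ) ^ 2 + 2 * (d : ℚ))
          * (Fintype.card F : ℚ) ^ (3 * m)) ∧
    (∀ D : ℕ, 0 < D → D < d →
      ({t : SliceParam F m | HasGeomFactorOfDegreeLE (planeSlice f t) D}.ncard : ℚ) ≤
        (d : ℚ) / 8 * (-(D : ℚ) ^ 4 + 4 * (D : ℚ) ^ 3 * (d : ℚ) - 6 * (D : ℚ) ^ 3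
            + 12 * (D : ℚ) ^ 2 * (d : ℚ) - 11 * (D : ℚ) ^ 2 + 8 * (D : ℚ) * (d : ℚ)
            - 6 * (D : ℚ) + 16 * (d : ℚ))
          * (Fintype.card F : ℚ) ^ (3 * m)) := by
  let φ := algebraMap F (AlgebraicClosure F)
  let g := MvPolynomial.map φ f
  have hg : Irreducible g := hf
  have hgd : g.totalDegree = d := by
    rw [← hd, MvPolynomial.totalDegree, MvPolynomial.totalDegree,
      MvPolynomial.support_map_of_injective f φ.injective]
  have hd0 : 0 < g.totalDegree :=
    MvPolynomial.totalDegree_pos_of_not_isUnit hg.ne_zero hg.not_isUnit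
  obtain ⟨p, hchar⟩ := CharP.exists F
  have hp : Fact p.Prime := ⟨CharP.char_is_prime F p⟩
  have : CharP (AlgebraicClosure F) p := charP_of_injective_algebraMap φ.injective p
  have : ExpChar (AlgebraicClosure F) p := ExpChar.prime hp.out
  have : Infinite (AlgebraicClosure F) := IsAlgClosed.instInfinite
  have hE := lineDiscriminant_ne_zero hg (MvPolynomial.exists_pderiv_ne_zero p hg)
  have hEd := totalDegree_lineDiscriminant_le g hd0
  rw [hgd] at hEd
  have hq : (0 : ℚ) ≤ (Fintype.card F : ℚ) ^ (3 * m) := by positivity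
  constructor
  · have h1 := ncard_sliceParam_le φ (fun t => ¬ AbsolutelyIrreducible (planeSlice f t)) _ hE
      (minorDegree d (d - 1)) fun v w hvw => by
        obtain ⟨Δ, hΔ0, hΔd, hΔ⟩ := exists_polynomial_of_reducible hg hd0 hvw
        rw [hgd] at hΔd
        refine ⟨Δ, hΔ0, hΔd, fun z hz => hΔ _ ?_⟩
        rwa [AbsolutelyIrreducible, map_planeSlice] at hz
    have h2 := h1.trans (Nat.mul_le_mul_right _ (Nat.add_le_add_right hEd _))
    refine ((Nat.cast_le (α := ℚ)).mpr h2).trans ?_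
    push_cast
    refine mul_le_mul_of_nonneg_right ?_ hq
    -- Writing `d = e + 1` removes the truncated `d - 1` before casting.
    obtain ⟨e, rfl⟩ : ∃ e, d = e + 1 := ⟨d - 1, by omega⟩
    have h3 := cast_minorDegree_le (Nat.lt_succ_self e)
    rw [Nat.add_sub_cancel]
    push_cast at h3 ⊢
    linarith
  · intro D _ hD
    have h1 := ncard_sliceParam_le φ (fun t => HasGeomFactorOfDegreeLE (planeSlice f t) D) _ hE
      (d * minorDegree d D) fun v w hvw => by
        obtain ⟨Δ, hΔ0, hΔd, hΔ⟩ := exists_polynomial_of_factor hg hvw (hgd.symm ▸ hD)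
        rw [hgd] at hΔd
        refine ⟨Δ, hΔ0, hΔd, fun z hz => hΔ _ ?_⟩
        rwa [HasGeomFactorOfDegreeLE, map_planeSlice] at hz
    have h2 := h1.trans (Nat.mul_le_mul_right _ (Nat.add_le_add_right hEd _))
    refine ((Nat.cast_le (α := ℚ)).mpr h2).trans ?_
    push_cast
    refine mul_le_mul_of_nonneg_right ?_ hq
    have h3 := mul_le_mul_of_nonneg_left (cast_minorDegree_le hD) (Nat.cast_nonneg (α := ℚ) d)
    linarith
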